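/- **Sparse-dense equivalence for CDMA channels.** Fix a noise level $\sigma>0$. For an $m\times n$ real matrix $A$ let $$C_n(A)=\log 2-\frac{m}{2n}-\frac1n\,\mathbb E_Y\log\Big\{\sum_{x\in\{+1,-1\}^n}e^{-\frac{1}{2\sigma^2}\|Y-Ax\|_2^2}\Big\}$$ be the capacity per user (in nats) of the CDMA system with signature matrix $A$. Here $Y=AX+\sigma Z$, with $X$ uniform on $\{+1,-1\}^n$ and $Z$ independent of $X$ with i.i.d. $N(0,1)$ components. Let $\alpha>0$, and let $m=m_n$ be a sequence of integers with $m_n/n\to\alpha$ as $n\to\infty$. A sequence of random $m_n\times n$ matrices $\mathbf A_n=(A_{ij})$ is called of standard type if, for each $n$, the entries are i.i.d. with $\mathbb E[A_{ij}]=0$, $\mathbb E[A_{ij}^2]=1$ and $\mathbb E[A_{ij}^6]\le K<\infty$, for some $K$ independent of $n$. For $0<\gamma\le n$, the sparsification $\mathbf A_n^\gamma$ of $\mathbf A_n$ is obtained by keeping each entry with probability $\gamma/n$ and replacing it by $0$ with probability $1-\gamma/n$, independently over the entries and independently of $\mathbf A_n$. Let $\mathbf A_n$ and $\mathbf B_n$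 be two sequences of random $m_n\times n$ matrices of standard type. Then $$\lim_{\gamma\to\infty}\ \limsup_{n\to\infty}\ \Big|\mathbb E\big[C_n(\gamma^{-1/2}\mathbf A_n^\gamma)\big]-\mathbb E\big[C_n(n^{-1/2}\mathbf B_n)\big]\Big|=0 .$$ In particular, whenever the limit over $n$ of the difference exists for all large $\gamma$, the iterated limit (first $n\to\infty$, then $\gamma\to\infty$) of the difference is $0$. -/

import Mathlib

open MeasureTheory ProbabilityTheory Filter Topology

noncomputable section

namespace CDMA

/-- A sequence of random matrices of standard type: `A n` is a random `m n × n` matrix on the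
probability space `(Ω n, P n)` whose entries are independent and identically distributed, with mean
`0`, second moment `1`, and sixth moment at most some `K` that does not depend on `n`. -/
structure IsStandardType {m : ℕ → ℕ} {Ω : ℕ → Type*} [∀ n, MeasurableSpace (Ω n)]
    (P : ∀ n, Measure (Ω n)) (A : ∀ n, Ω n → Matrix (Fin (m n)) (Fin n) ℝ) : Prop where
  measurable : ∀ n i j, Measurable fun ω => A n ω i j
  indep : ∀ n, iIndepFun (fun (q : Fin (m n) × Fin n) ω => A n ω q.1 q.2) (P n)
  identDistrib : ∀ n i j i' j',
    IdentDistrib (fun ω => A n ω i j) (fun ω => A n ω i' j') (P n) (P n)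
  mean : ∀ n i j, ∫ ω, A n ω i j ∂P n = 0
  variance : ∀ n i j, ∫ ω, A n ω i j ^ 2 ∂P n = 1
  sixthMoment : ∃ K : ℝ, ∀ n i j,
    Integrable (fun ω => A n ω i j ^ 6) (P n) ∧ ∫ ω, A n ω i j ^ 6 ∂P n ≤ K

/-- The antipodal symbol `+1` or `-1` encoded by a Boolean. -/
def symbol (b : Bool) : ℝ := if b then 1 else -1

/-- The vector in `{+1, -1}ⁿ` encoded by a Boolean vector. -/
def symbols {n : ℕ} (x : Fin n → Bool) : Fin n → ℝ := fun k => symbol (x k)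

/-- The received signal `Y = A x + σ z`. -/
def received {m n : ℕ} (σ : ℝ) (A : Matrix (Fin m) (Fin n) ℝ) (x : Fin n → Bool)
    (z : Fin m → ℝ) : Fin m → ℝ :=
  fun i => A.mulVec (symbols x) i + σ * z i

/-- The expectation of `g Y` over the received signal `Y = A X + σ Z`, where `X` is uniform on
`{+1, -1}ⁿ` and `Z`, independent of `X`, has i.i.d. standard Gaussian components. -/
def expectReceived {m n : ℕ} (σ : ℝ) (A : Matrix (Fin m) (Fin n) ℝ)
    (g : (Fin m → ℝ) → ℝ) : ℝ :=
  (1 / 2 ^ n) * ∑ x : Fin n → Bool,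
    ∫ z, g (received σ A x z) ∂(Measure.pi fun _ : Fin m => gaussianReal 0 1)

/-- `∑_{x ∈ {+1,-1}ⁿ} exp (-‖y - A x‖₂² / (2 σ²))`. -/
def partitionFunction {m n : ℕ} (σ : ℝ) (A : Matrix (Fin m) (Fin n) ℝ) (y : Fin m → ℝ) : ℝ :=
  ∑ x : Fin n → Bool,
    Real.exp (-(1 / (2 * σ ^ 2)) * ∑ i, (y i - A.mulVec (symbols x) i) ^ 2)

/-- The capacity per user, in natural units, of the CDMA system with `n` users, spreading gain `m`,
signature matrix `A`, uniform antipodal symbols and noise power `σ²`. -/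
def capacity {m n : ℕ} (σ : ℝ) (A : Matrix (Fin m) (Fin n) ℝ) : ℝ :=
  Real.log 2 - (1 / 2) * ((m : ℝ) / n)
    - (1 / n) * expectReceived σ A fun y => Real.log (partitionFunction σ A y)

/-- The law of an `m × n` array of independent Boolean marks, each equal to `true` with probability
`γ / n` (truncated to `[0, 1]`, which is immaterial when `0 ≤ γ ≤ n`). -/
def maskLaw (γ : ℝ) (m n : ℕ) : Measure (Fin m × Fin n → Bool) :=
  Measure.pi fun _ => bernoulliMeasure true false (Set.projIcc (0 : ℝ) 1 zero_le_one (γ / n))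

/-- Keep the entries of `A` that are marked `true`, and replace the other ones by `0`. -/
def keep {m n : ℕ} (A : Matrix (Fin m) (Fin n) ℝ) (s : Fin m × Fin n → Bool) :
    Matrix (Fin m) (Fin n) ℝ :=
  Matrix.of fun i j => if s (i, j) then A i j else 0

/-- `E[C_n(n^{-1/2} B)]` for a random matrix `B` on `(Ω, P)`. -/
def denseCapacity {m n : ℕ} {Ω : Type*} [MeasurableSpace Ω] (σ : ℝ) (P : Measure Ω)
    (B : Ω → Matrix (Fin m) (Fin n) ℝ) : ℝ :=
  ∫ ω, capacity σ ((Real.sqrt n)⁻¹ • B ω) ∂P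

/-- `E[C_n(γ^{-1/2} A^γ)]` for a random matrix `A` on `(Ω, P)`, where the sparsification `A^γ` keeps
each entry of `A` with probability `γ / n` and replaces it by `0` otherwise, independently over the
entries and independently of `A`. -/
def sparseCapacity {m n : ℕ} {Ω : Type*} [MeasurableSpace Ω] (σ γ : ℝ) (P : Measure Ω)
    (A : Ω → Matrix (Fin m) (Fin n) ℝ) : ℝ :=
  ∫ q, capacity σ ((Real.sqrt γ)⁻¹ • keep (A q.1) q.2) ∂(P.prod (maskLaw γ m n))

end CDMA

end

/-!
The capacity is an affine function of the mean log-partition function `E log Z`, so the theorem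
compares `E log Z` for two random matrices with independent centred entries of the same variance
`1 / n`. This is done by the Lindeberg exchange: replacing the entries one at a time
(`lindeberg_exchange`), each replacement costs at most a constant times the third absolute moments
of the two laws, provided that `E log Z` has a bounded third derivative in every entry.

That bound, uniform in the matrix and in the dimensions, is the heart of the matter
(`meanLogPartition_quadratic_approx`). The energy is quadratic in an entry, and its first derivative
is a bounded multiple of the residual `(y - A x)_i`; so the third derivative of `log Z` is
controlled by the Gibbs average of `|(y - A x)_i|³` (`abs_logSumExpDeriv₃_le`). The Gibbs measure
is the posterior law of the input given the received signal. By the Nishimori identity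
(`nishimori`) a sample from it may therefore be replaced, on average, by the true input, whose
residual is just the noise `σ z_i`: the average is `σ³ E|Z|³` for every matrix (`average_gibbs_residual`).

An entry of the sparsified matrix has third absolute moment at most `γ^{-1/2} (1 + K) / n`, one of
the dense matrix at most `n^{-1/2} (1 + K') / n`. Summed over the `m n` entries and divided by `n`,
the exchange costs `O((m / n) (γ^{-1/2} + n^{-1/2}))` (`abs_sparseCapacity_sub_denseCapacity_le`),
which vanishes when first `n` and then `γ` tends to infinity.
-/

noncomputable section

namespace CDMA

/-! ### The Lindeberg exchange on product measures -/

theorem measurable_update_prod {ι : Type*} [DecidableEq ι] (q : ι) :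
    Measurable fun p : (ι → ℝ) × ℝ => Function.update p.1 q p.2 := by
  refine measurable_pi_lambda _ fun i => ?_
  by_cases h : i = q
  · subst h; simpa using measurable_snd
  · simp only [Function.update_of_ne h]; fun_prop

/-- Overwriting the `q`-th coordinate by an independent sample of `η` replaces the `q`-th factor of
a product measure by `η`. -/
theorem map_update_prod_pi {ι : Type*} [Fintype ι] [DecidableEq ι] (ρ : ι → Measure ℝ)
    [∀ i, IsProbabilityMeasure (ρ i)] (q : ι) (η : Measure ℝ) [IsProbabilityMeasure η] :
    ((Measure.pi ρ).prod η).map (fun p : (ι → ℝ) × ℝ => Function.update p.1 q p.2)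
      = Measure.pi (Function.update ρ q η) := by
  have hmeas := measurable_update_prod q
  have hprob : ∀ i, IsProbabilityMeasure (Function.update ρ q η i) := by
    intro i
    by_cases h : i = q
    · subst h; simpa
    · rw [Function.update_of_ne h]; infer_instance
  symm
  refine Measure.pi_eq fun s hs => ?_
  rw [Measure.map_apply hmeas (MeasurableSet.univ_pi hs)]
  have hpre : (fun p : (ι → ℝ) × ℝ => Function.update p.1 q p.2) ⁻¹' (Set.univ.pi s)
      = (Set.univ.pi (Function.update s q Set.univ)) ×ˢ s q := by
    ext ⟨M, t⟩
    simp only [Set.mem_preimage, Set.mem_pi, Set.mem_univ, true_implies, Set.mem_prod]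
    constructor
    · intro h
      refine ⟨fun i => ?_, by simpa using h q⟩
      by_cases hi : i = q
      · subst hi; simp
      · simpa [Function.update_of_ne hi] using h i
    · rintro ⟨h, ht⟩ i
      by_cases hi : i = q
      · subst hi; simpa using ht
      · simpa [Function.update_of_ne hi] using h i
  rw [hpre, Measure.prod_prod, Measure.pi_pi, ← Finset.mul_prod_erase _ _ (Finset.mem_univ q),
    ← Finset.mul_prod_erase _ (fun i => Function.update ρ q η i (s i)) (Finset.mem_univ q)]
  simp only [Function.update_self, measure_univ, one_mul]
  rw [mul_comm]
  congr 1
  refine Finset.prod_congr rfl fun i hi => ?_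
  rw [Function.update_of_ne (Finset.ne_of_mem_erase hi),
    Function.update_of_ne (Finset.ne_of_mem_erase hi)]

/-- Resampling one coordinate of a product measure: the integral over the product in which the
`q`-th factor is `η` can be computed with an arbitrary `q`-th factor for the frozen coordinates. -/
theorem integral_pi_update {ι : Type*} [Fintype ι] [DecidableEq ι] (ρ : ι → Measure ℝ)
    [∀ i, IsProbabilityMeasure (ρ i)] (q : ι) (η : Measure ℝ) [IsProbabilityMeasure η]
    {F : (ι → ℝ) → ℝ} (hF : Measurable F) {C : ℝ} (hC : ∀ v, |F v| ≤ C) :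
    Integrable (fun M => ∫ t, F (Function.update M q t) ∂η) (Measure.pi ρ) ∧
    ∫ v, F v ∂(Measure.pi (Function.update ρ q η))
      = ∫ M, ∫ t, F (Function.update M q t) ∂η ∂(Measure.pi ρ) := by
  have hmeas := measurable_update_prod q
  have hint : Integrable (fun p : (ι → ℝ) × ℝ => F (Function.update p.1 q p.2))
      ((Measure.pi ρ).prod η) :=
    Integrable.of_bound (hF.comp hmeas).aestronglyMeasurable C (.of_forall fun p => hC _)
  refine ⟨hint.integral_prod_left, ?_⟩
  rw [← map_update_prod_pi, integral_map hmeas.aemeasurable hF.aestronglyMeasurable,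
    integral_prod _ hint]

/-- Two laws with the same first two moments give nearly the same integral to a function that is a
quadratic polynomial up to a cubic error. -/
theorem abs_integral_sub_integral_le {μ ν : Measure ℝ} [IsProbabilityMeasure μ]
    [IsProbabilityMeasure ν] {f : ℝ → ℝ} (hfμ : Integrable f μ) (hfν : Integrable f ν)
    {a b c L : ℝ} (hf : ∀ t, |f t - (a + b * t + c * t ^ 2)| ≤ L * |t| ^ 3)
    (hμ1 : Integrable (fun t => t) μ) (hν1 : Integrable (fun t => t) ν)
    (hμ2 : Integrable (fun t => t ^ 2) μ) (hν2 : Integrable (fun t => t ^ 2) ν)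
    (hμ3 : Integrable (fun t => |t| ^ 3) μ) (hν3 : Integrable (fun t => |t| ^ 3) ν)
    (h1 : ∫ t, t ∂μ = ∫ t, t ∂ν) (h2 : ∫ t, t ^ 2 ∂μ = ∫ t, t ^ 2 ∂ν) :
    |∫ t, f t ∂μ - ∫ t, f t ∂ν| ≤ L * (∫ t, |t| ^ 3 ∂μ + ∫ t, |t| ^ 3 ∂ν) := by
  have key : ∀ (η : Measure ℝ) [IsProbabilityMeasure η], Integrable f η →
      Integrable (fun t => t) η → Integrable (fun t => t ^ 2) η → Integrable (fun t => |t| ^ 3) η →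
      |∫ t, f t ∂η - (a + b * ∫ t, t ∂η + c * ∫ t, t ^ 2 ∂η)| ≤ L * ∫ t, |t| ^ 3 ∂η := by
    intro η _ hf0 hi1 hi2 hi3
    have hq : ∫ t, (a + b * t + c * t ^ 2) ∂η = a + b * ∫ t, t ∂η + c * ∫ t, t ^ 2 ∂η := by
      rw [integral_add (f := fun t => a + b * t)
        ((integrable_const a).add (hi1.const_mul b)) (hi2.const_mul c),
        integral_add (integrable_const a) (hi1.const_mul b), integral_const_mul,
        integral_const_mul]
      simp
    have hqi : Integrable (fun t => a + b * t + c * t ^ 2) η :=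
      ((integrable_const a).add (hi1.const_mul b)).add (hi2.const_mul c)
    rw [← hq, ← integral_sub hf0 hqi, ← integral_const_mul]
    exact (abs_integral_le_integral_abs).trans
      (integral_mono (hf0.sub hqi).abs (hi3.const_mul L) hf)
  have k1 := key μ hfμ hμ1 hμ2 hμ3
  have k2 := key ν hfν hν1 hν2 hν3
  rw [h1, h2] at k1
  rw [mul_add]
  rw [abs_le] at *
  constructor <;> linarith [k1.1, k1.2, k2.1, k2.2]

/-- The **Lindeberg exchange principle** for product measures: exchanging the factors one at a time,
the integral of a function that is quadratic in each coordinate up to a cubic error changes only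
through the third absolute moments. -/
theorem lindeberg_exchange {ι : Type*} [Fintype ι] [DecidableEq ι] {μ ν : ι → Measure ℝ}
    [∀ i, IsProbabilityMeasure (μ i)] [∀ i, IsProbabilityMeasure (ν i)] {F : (ι → ℝ) → ℝ}
    (hF : Measurable F) {C : ℝ} (hC : ∀ v, |F v| ≤ C) {L : ℝ} (hL0 : 0 ≤ L)
    (hL : ∀ M q, ∃ a b c : ℝ, ∀ t,
      |F (Function.update M q t) - (a + b * t + c * t ^ 2)| ≤ L * |t| ^ 3)
    (hμ1 : ∀ i, Integrable (fun t => t) (μ i)) (hν1 : ∀ i, Integrable (fun t => t) (ν i))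
    (hμ2 : ∀ i, Integrable (fun t => t ^ 2) (μ i)) (hν2 : ∀ i, Integrable (fun t => t ^ 2) (ν i))
    (hμ3 : ∀ i, Integrable (fun t => |t| ^ 3) (μ i))
    (hν3 : ∀ i, Integrable (fun t => |t| ^ 3) (ν i))
    (h1 : ∀ i, ∫ t, t ∂(μ i) = ∫ t, t ∂(ν i))
    (h2 : ∀ i, ∫ t, t ^ 2 ∂(μ i) = ∫ t, t ^ 2 ∂(ν i)) {a b : ℝ}
    (ha : ∀ i, ∫ t, |t| ^ 3 ∂(μ i) ≤ a) (hb : ∀ i, ∫ t, |t| ^ 3 ∂(ν i) ≤ b) :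
    |∫ v, F v ∂(Measure.pi μ) - ∫ v, F v ∂(Measure.pi ν)|
      ≤ Fintype.card ι * (L * (a + b)) := by
  let ρ : Finset ι → ι → Measure ℝ := fun S i => if i ∈ S then μ i else ν i
  have hρ : ∀ S i, IsProbabilityMeasure (ρ S i) := by
    intro S i; simp only [ρ]; split_ifs <;> infer_instance
  suffices h : ∀ S : Finset ι,
      |∫ v, F v ∂(Measure.pi (ρ S)) - ∫ v, F v ∂(Measure.pi (ρ ∅))| ≤ S.card * (L * (a + b)) by
    simpa [ρ] using h Finset.univ
  intro S
  induction S using Finset.induction_on with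
  | empty => simp
  | insert q S hq ih =>
    have e1 : ρ (insert q S) = Function.update (ρ S) q (μ q) := by
      funext i
      by_cases hi : i = q
      · subst hi; simp [ρ]
      · simp [ρ, hi]
    have e2 : ρ S = Function.update (ρ S) q (ν q) := by
      funext i
      by_cases hi : i = q
      · subst hi; simp [ρ, hq]
      · simp [Function.update_of_ne hi]
    have step : |∫ v, F v ∂(Measure.pi (ρ (insert q S))) - ∫ v, F v ∂(Measure.pi (ρ S))|
        ≤ L * (a + b) := by
      obtain ⟨i1, j1⟩ := integral_pi_update (ρ S) q (μ q) hF hC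
      obtain ⟨i2, j2⟩ := integral_pi_update (ρ S) q (ν q) hF hC
      rw [e1, j1]
      conv_lhs => rw [e2, j2]
      rw [← e2, ← integral_sub i1 i2]
      have hmeas : ∀ M : ι → ℝ, Measurable fun t => F (Function.update M q t) := fun M =>
        hF.comp (measurable_update M)
      have hbd : ∀ M : ι → ℝ, ‖∫ t, F (Function.update M q t) ∂(μ q)
          - ∫ t, F (Function.update M q t) ∂(ν q)‖ ≤ L * (a + b) := by
        intro M
        obtain ⟨a', b', c', h⟩ := hL M q
        refine (abs_integral_sub_integral_le
          (Integrable.of_bound (hmeas M).aestronglyMeasurable C (.of_forall fun p => hC _))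
          (Integrable.of_bound (hmeas M).aestronglyMeasurable C (.of_forall fun p => hC _))
          h (hμ1 q) (hν1 q) (hμ2 q) (hν2 q) (hμ3 q) (hν3 q) (h1 q) (h2 q)).trans ?_
        exact mul_le_mul_of_nonneg_left (add_le_add (ha q) (hb q)) hL0
      simpa using norm_integral_le_of_norm_le_const (μ := Measure.pi (ρ S)) (.of_forall hbd)
    rw [Finset.card_insert_of_notMem hq]
    push_cast
    calc _ ≤ _ := abs_sub_le _ (∫ v, F v ∂(Measure.pi (ρ S))) _
      _ ≤ L * (a + b) + S.card * (L * (a + b)) := add_le_add step ih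
      _ = _ := by ring

/-! ### Gibbs averages and derivatives of the log-partition function -/

/-- The average of `g` under the Gibbs measure with weights proportional to `exp (E x)`. -/
def gibbs {ι : Type*} [Fintype ι] (E g : ι → ℝ) : ℝ :=
  (∑ x, g x * Real.exp (E x)) / ∑ x, Real.exp (E x)

section Gibbs

variable {ι : Type*} [Fintype ι]

theorem gibbs_add (E g h : ι → ℝ) : gibbs E (fun x => g x + h x) = gibbs E g + gibbs E h := by
  unfold gibbs
  rw [← add_div, ← Finset.sum_add_distrib]
  simp only [add_mul]

theorem gibbs_const_mul (E g : ι → ℝ) (c : ℝ) :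
    gibbs E (fun x => c * g x) = c * gibbs E g := by
  unfold gibbs
  rw [← mul_div_assoc, Finset.mul_sum]
  simp only [mul_assoc]

variable [Nonempty ι]

theorem sum_exp_pos (E : ι → ℝ) : 0 < ∑ x, Real.exp (E x) :=
  Finset.sum_pos (fun _ _ => Real.exp_pos _) Finset.univ_nonempty

theorem gibbs_mono (E : ι → ℝ) {g h : ι → ℝ} (hgh : ∀ x, g x ≤ h x) : gibbs E g ≤ gibbs E h := by
  have := sum_exp_pos E
  unfold gibbs
  gcongr with x
  exact hgh x

theorem gibbs_const (E : ι → ℝ) (c : ℝ) : gibbs E (fun _ => c) = c := by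
  have := sum_exp_pos E
  unfold gibbs
  rw [← Finset.mul_sum]
  field_simp

theorem gibbs_nonneg (E : ι → ℝ) {g : ι → ℝ} (hg : ∀ x, 0 ≤ g x) : 0 ≤ gibbs E g :=
  (gibbs_const E 0).symm.le.trans (gibbs_mono E hg)

theorem gibbs_le (E : ι → ℝ) {g : ι → ℝ} {c : ℝ} (hg : ∀ x, g x ≤ c) : gibbs E g ≤ c :=
  (gibbs_mono E hg).trans (gibbs_const E c).le

theorem abs_gibbs_le (E : ι → ℝ) {g h : ι → ℝ} (hgh : ∀ x, |g x| ≤ h x) :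
    |gibbs E g| ≤ gibbs E h := by
  have e : -gibbs E h = gibbs E (fun x => -1 * h x) := by rw [gibbs_const_mul]; ring
  rw [abs_le, e]
  exact ⟨gibbs_mono E fun x => by linarith [(abs_le.1 (hgh x)).1],
    gibbs_mono E fun x => (abs_le.1 (hgh x)).2⟩

/-- The power mean inequality for a Gibbs average. -/
theorem gibbs_pow_le (E : ι → ℝ) {u : ι → ℝ} (hu : ∀ x, 0 ≤ u x) :
    gibbs E u ^ 3 ≤ gibbs E fun x => u x ^ 3 := by
  have ha := gibbs_nonneg E hu
  set a := gibbs E u with hadef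
  -- the tangent line of the cube at the mean lies below the cube
  have h : gibbs E (fun x => 3 * a ^ 2 * u x + -2 * a ^ 3) ≤ gibbs E fun x => u x ^ 3 := by
    refine gibbs_mono E fun x => ?_
    nlinarith [mul_nonneg (add_nonneg (hu x) (add_nonneg ha ha)) (sq_nonneg (u x - a))]
  rw [gibbs_add, gibbs_const_mul, gibbs_const, ← hadef] at h
  linarith

/-- Chebyshev's sum inequality for the first two powers, from `3 a u² ≤ 2 u³ + a³`. -/
theorem gibbs_mul_gibbs_sq_le (E : ι → ℝ) {u : ι → ℝ} (hu : ∀ x, 0 ≤ u x) :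
    gibbs E u * gibbs E (fun x => u x ^ 2) ≤ gibbs E fun x => u x ^ 3 := by
  have ha := gibbs_nonneg E hu
  have h3 := gibbs_pow_le E hu
  set a := gibbs E u with hadef
  have h : gibbs E (fun x => a * u x ^ 2) ≤ gibbs E (fun x => 2 / 3 * u x ^ 3 + a ^ 3 / 3) := by
    refine gibbs_mono E fun x => ?_
    nlinarith [mul_nonneg (add_nonneg (add_nonneg (hu x) (hu x)) ha) (sq_nonneg (u x - a))]
  rw [gibbs_add, gibbs_const_mul, gibbs_const_mul, gibbs_const] at h
  linarith

theorem gibbs_le_one_add (E : ι → ℝ) {u : ι → ℝ} (hu : ∀ x, 0 ≤ u x) :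
    gibbs E u ≤ 1 + gibbs E fun x => u x ^ 3 := by
  have h := gibbs_mono E (g := u) (h := fun x => 1 + u x ^ 3) fun x => by
    nlinarith [hu x, sq_nonneg (u x - 1), mul_nonneg (hu x) (sq_nonneg (u x - 1)), sq_nonneg (u x)]
  rwa [gibbs_add, gibbs_const] at h

theorem hasDerivAt_gibbs {H H' g g' : ι → ℝ → ℝ} {t : ℝ}
    (hH : ∀ x, HasDerivAt (H x) (H' x t) t) (hg : ∀ x, HasDerivAt (g x) (g' x t) t) :
    HasDerivAt (fun t => gibbs (fun x => H x t) fun x => g x t)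
      (gibbs (fun x => H x t) (fun x => g' x t + g x t * H' x t)
        - gibbs (fun x => H x t) (fun x => g x t) * gibbs (fun x => H x t) fun x => H' x t) t := by
  have hZ := sum_exp_pos fun x => H x t
  have hN : HasDerivAt (fun t => ∑ x, g x t * Real.exp (H x t))
      (∑ x, (g' x t * Real.exp (H x t) + g x t * (Real.exp (H x t) * H' x t))) t :=
    HasDerivAt.fun_sum fun x _ => (hg x).mul (hH x).exp
  have hD : HasDerivAt (fun t => ∑ x, Real.exp (H x t))
      (∑ x, Real.exp (H x t) * H' x t) t := HasDerivAt.fun_sum fun x _ => (hH x).exp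
  refine (hN.fun_div hD hZ.ne').congr_deriv ?_
  unfold gibbs
  have e1 : ∑ x, (g' x t * Real.exp (H x t) + g x t * (Real.exp (H x t) * H' x t))
      = ∑ x, (g' x t + g x t * H' x t) * Real.exp (H x t) :=
    Finset.sum_congr rfl fun x _ => by ring
  have e2 : ∑ x, Real.exp (H x t) * H' x t = ∑ x, H' x t * Real.exp (H x t) :=
    Finset.sum_congr rfl fun x _ => by ring
  rw [e1, e2]
  field_simp

theorem hasDerivAt_log_sum_exp {H H' : ι → ℝ → ℝ} {t : ℝ}
    (hH : ∀ x, HasDerivAt (H x) (H' x t) t) :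
    HasDerivAt (fun t => Real.log (∑ x, Real.exp (H x t)))
      (gibbs (fun x => H x t) fun x => H' x t) t := by
  have hD : HasDerivAt (fun t => ∑ x, Real.exp (H x t))
      (∑ x, Real.exp (H x t) * H' x t) t := HasDerivAt.fun_sum fun x _ => (hH x).exp
  refine (hD.log (sum_exp_pos _).ne').congr_deriv ?_
  unfold gibbs
  simp only [mul_comm]

/-- The second derivative of the logarithm of `∑ x, exp (H x)`, for energies with first derivative
`h` and second derivative `s`. -/
def logSumExpDeriv₂ {ι : Type*} [Fintype ι] (H h s : ι → ℝ) : ℝ :=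
  gibbs H (fun x => s x + h x * h x) - gibbs H h * gibbs H h

/-- The third derivative of the logarithm of `∑ x, exp (H x)`, for energies with first derivative
`h`, second derivative `s` and vanishing third derivative. -/
def logSumExpDeriv₃ {ι : Type*} [Fintype ι] (H h s : ι → ℝ) : ℝ :=
  gibbs H (fun x => (s x * h x + h x * s x) + (s x + h x * h x) * h x)
    - gibbs H (fun x => s x + h x * h x) * gibbs H h
    - (logSumExpDeriv₂ H h s * gibbs H h + gibbs H h * logSumExpDeriv₂ H h s)

theorem hasDerivAt_logSumExpDeriv₁ {H h : ι → ℝ → ℝ} {s : ι → ℝ} {t : ℝ}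
    (hH : ∀ x, HasDerivAt (H x) (h x t) t) (hh : ∀ x, HasDerivAt (h x) (s x) t) :
    HasDerivAt (fun t => gibbs (fun x => H x t) fun x => h x t)
      (logSumExpDeriv₂ (fun x => H x t) (fun x => h x t) s) t :=
  hasDerivAt_gibbs (g' := fun x _ => s x) hH hh

theorem hasDerivAt_logSumExpDeriv₂ {H h : ι → ℝ → ℝ} {s : ι → ℝ} {t : ℝ}
    (hH : ∀ x, HasDerivAt (H x) (h x t) t) (hh : ∀ x, HasDerivAt (h x) (s x) t) :
    HasDerivAt (fun t => logSumExpDeriv₂ (fun x => H x t) (fun x => h x t) s)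
      (logSumExpDeriv₃ (fun x => H x t) (fun x => h x t) s) t := by
  have h1 := hasDerivAt_logSumExpDeriv₁ hH hh
  have h2 := hasDerivAt_gibbs (g := fun x t => s x + h x t * h x t)
    (g' := fun x t => s x * h x t + h x t * s x) hH
    (fun x => ((hh x).mul (hh x)).const_add (s x))
  exact h2.sub (h1.mul h1)

theorem abs_logSumExpDeriv₂_le (H : ι → ℝ) {h s : ι → ℝ} {D U : ℝ} (hs : ∀ x, |s x| ≤ D)
    (hU : ∀ x, |h x| ≤ U) : |logSumExpDeriv₂ H h s| ≤ D + 2 * U ^ 2 := by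
  have hU0 : 0 ≤ U := (abs_nonneg _).trans (hU (Classical.arbitrary ι))
  have h1 : |gibbs H h| ≤ U := (abs_gibbs_le H hU).trans (gibbs_const H U).le
  have h2 : |gibbs H fun x => s x + h x * h x| ≤ D + U * U := by
    refine (abs_gibbs_le H fun x => ?_).trans (gibbs_const H _).le
    refine (abs_add_le _ _).trans (add_le_add (hs x) ?_)
    rw [abs_mul]
    exact mul_le_mul (hU x) (hU x) (abs_nonneg _) hU0
  have h3 : |gibbs H h * gibbs H h| ≤ U * U := by
    rw [abs_mul]
    exact mul_le_mul h1 h1 (abs_nonneg _) hU0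
  unfold logSumExpDeriv₂
  rw [abs_le] at *
  constructor <;> linarith [h2.1, h2.2, h3.1, h3.2]

/-- The third derivative of a log-partition function is controlled by the third absolute moment of
the first derivative of the energy under the Gibbs measure. -/
theorem abs_logSumExpDeriv₃_le (H : ι → ℝ) {h s : ι → ℝ} {D : ℝ} (hs : ∀ x, |s x| ≤ D) :
    |logSumExpDeriv₃ H h s| ≤ 6 * D + (6 * D + 6) * gibbs H fun x => |h x| ^ 3 := by
  have hD : 0 ≤ D := (abs_nonneg _).trans (hs (Classical.arbitrary ι))
  have hu : ∀ x, 0 ≤ |h x| := fun x => abs_nonneg _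
  have b1 := gibbs_le_one_add H hu
  have b2 := gibbs_mul_gibbs_sq_le H hu
  have b3 := gibbs_pow_le H hu
  have a0 := gibbs_nonneg H hu
  have c1 : |gibbs H h| ≤ gibbs H fun x => |h x| := abs_gibbs_le H fun x => le_rfl
  have c2 : |gibbs H fun x => s x + h x * h x| ≤ D + gibbs H fun x => |h x| ^ 2 := by
    have e := gibbs_add H (fun _ => D) fun x => |h x| ^ 2
    rw [gibbs_const] at e
    rw [← e]
    refine abs_gibbs_le H fun x => ?_
    refine (abs_add_le _ _).trans (add_le_add (hs x) ?_)
    rw [abs_mul, sq]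
  have c3 : |gibbs H fun x => (s x * h x + h x * s x) + (s x + h x * h x) * h x|
      ≤ 3 * D * (gibbs H fun x => |h x|) + gibbs H fun x => |h x| ^ 3 := by
    rw [← gibbs_const_mul, ← gibbs_add]
    refine abs_gibbs_le H fun x => ?_
    have : (s x * h x + h x * s x) + (s x + h x * h x) * h x = 3 * (s x * h x) + h x ^ 3 := by ring
    rw [this]
    refine (abs_add_le _ _).trans ?_
    rw [abs_mul, abs_mul, abs_pow, abs_of_pos (by norm_num : (0 : ℝ) < 3)]
    nlinarith [mul_le_mul_of_nonneg_right (hs x) (hu x)]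
  have e : logSumExpDeriv₃ H h s
      = gibbs H (fun x => (s x * h x + h x * s x) + (s x + h x * h x) * h x)
        - 3 * (gibbs H (fun x => s x + h x * h x) * gibbs H h) + 2 * gibbs H h ^ 3 := by
    unfold logSumExpDeriv₃ logSumExpDeriv₂; ring
  set a := gibbs H fun x => |h x|
  set q := gibbs H fun x => |h x| ^ 2
  set r := gibbs H fun x => |h x| ^ 3
  have c4 : |gibbs H (fun x => s x + h x * h x) * gibbs H h| ≤ (D + q) * a := by
    rw [abs_mul]
    exact mul_le_mul c2 c1 (abs_nonneg _) ((abs_nonneg _).trans c2)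
  have c5 : |gibbs H h ^ 3| ≤ a ^ 3 := by
    rw [abs_pow]; exact pow_le_pow_left₀ (abs_nonneg _) c1 3
  have c6 : D * a ≤ D * (1 + r) := mul_le_mul_of_nonneg_left b1 hD
  rw [e]
  rw [abs_le] at *
  constructor <;> nlinarith [c3.1, c3.2, c4.1, c4.2, c5.1, c5.2]

theorem abs_logSumExpDeriv₃_le_of_le (H : ι → ℝ) {h s : ι → ℝ} {D U : ℝ} (hs : ∀ x, |s x| ≤ D)
    (hU : ∀ x, |h x| ≤ U) : |logSumExpDeriv₃ H h s| ≤ 6 * D + (6 * D + 6) * U ^ 3 := by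
  have hD : 0 ≤ D := (abs_nonneg _).trans (hs (Classical.arbitrary ι))
  refine (abs_logSumExpDeriv₃_le H hs).trans ?_
  gcongr
  exact gibbs_le H fun x => pow_le_pow_left₀ (abs_nonneg _) (hU x) 3

@[fun_prop]
theorem continuous_gibbs {Z : Type*} [TopologicalSpace Z] {E g : Z → ι → ℝ} (hE : Continuous E)
    (hg : Continuous g) : Continuous fun z => gibbs (E z) (g z) := by
  unfold gibbs
  refine Continuous.div (by fun_prop) (by fun_prop) fun z => (sum_exp_pos _).ne'

theorem continuous_logSumExpDeriv₂ {Z : Type*} [TopologicalSpace Z] {H h : Z → ι → ℝ} (s : ι → ℝ)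
    (hH : Continuous H) (hh : Continuous h) :
    Continuous fun z => logSumExpDeriv₂ (H z) (h z) s := by
  unfold logSumExpDeriv₂
  fun_prop

theorem continuous_logSumExpDeriv₃ {Z : Type*} [TopologicalSpace Z] {H h : Z → ι → ℝ} (s : ι → ℝ)
    (hH : Continuous H) (hh : Continuous h) :
    Continuous fun z => logSumExpDeriv₃ (H z) (h z) s := by
  unfold logSumExpDeriv₃ logSumExpDeriv₂
  fun_prop

end Gibbs

/-! ### The Gaussian channel and the Nishimori identity -/

/-- The law of the standard Gaussian noise vector. -/
abbrev noise (m : ℕ) : Measure (Fin m → ℝ) := Measure.pi fun _ : Fin m => gaussianReal 0 1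

/-- The exponent `-‖y - A x‖² / (2 σ²)` of the posterior weight of `x`. -/
def energy {m n : ℕ} (σ : ℝ) (A : Matrix (Fin m) (Fin n) ℝ) (y : Fin m → ℝ)
    (x : Fin n → Bool) : ℝ :=
  -(1 / (2 * σ ^ 2)) * ∑ i, (y i - A.mulVec (symbols x) i) ^ 2

theorem partitionFunction_eq {m n : ℕ} (σ : ℝ) (A : Matrix (Fin m) (Fin n) ℝ) (y : Fin m → ℝ) :
    partitionFunction σ A y = ∑ x, Real.exp (energy σ A y x) := rfl

/-- A product of probability measures with Lebesgue densities has the product density. -/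
theorem pi_withDensity_ofReal {ι : Type*} [Fintype ι] {p : ι → ℝ → ℝ}
    (hp : ∀ i, Integrable (p i) volume) (hp0 : ∀ i t, 0 ≤ p i t)
    [∀ i, IsProbabilityMeasure ((volume : Measure ℝ).withDensity fun t => ENNReal.ofReal (p i t))] :
    (Measure.pi fun i => (volume : Measure ℝ).withDensity fun t => ENNReal.ofReal (p i t))
      = (volume : Measure (ι → ℝ)).withDensity fun y => ENNReal.ofReal (∏ i, p i (y i)) := by
  refine Measure.pi_eq fun s hs => ?_
  rw [withDensity_apply _ (MeasurableSet.univ_pi hs), ← lintegral_indicator (.univ_pi hs)]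
  have hi : ∀ i, Integrable ((s i).indicator (p i)) volume := fun i => (hp i).indicator (hs i)
  have hi0 : ∀ i t, 0 ≤ (s i).indicator (p i) t := fun i t =>
    Set.indicator_nonneg (fun t _ => hp0 i t) t
  have e : (Set.univ.pi s).indicator (fun y => ENNReal.ofReal (∏ i, p i (y i)))
      = fun y => ENNReal.ofReal (∏ i, (s i).indicator (p i) (y i)) := by
    funext y
    by_cases hy : y ∈ Set.univ.pi s
    · rw [Set.indicator_of_mem hy]
      congr 1
      exact Finset.prod_congr rfl fun i _ => (Set.indicator_of_mem (hy i trivial) _).symm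
    · rw [Set.indicator_of_notMem hy]
      simp only [Set.mem_pi, Set.mem_univ, true_implies, not_forall] at hy
      obtain ⟨i, hi⟩ := hy
      rw [Finset.prod_eq_zero (Finset.mem_univ i) (Set.indicator_of_notMem hi _)]
      simp
  rw [e, ← ofReal_integral_eq_lintegral_ofReal
    (volume_pi (α := fun _ : ι => ℝ) ▸ Integrable.fintype_prod hi)
    (.of_forall fun y => Finset.prod_nonneg fun i _ => hi0 i _),
    integral_fintype_prod_volume_eq_prod,
    ENNReal.ofReal_prod_of_nonneg fun i _ => integral_nonneg (hi0 i)]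
  refine Finset.prod_congr rfl fun i _ => ?_
  rw [withDensity_apply _ (hs i), ofReal_integral_eq_lintegral_ofReal (hi i)
    (.of_forall (hi0 i)), ← lintegral_indicator (hs i)]
  refine lintegral_congr fun t => ?_
  by_cases ht : t ∈ s i <;> simp [ht]

/-- The normalizing constant of the Gaussian density of the received signal. -/
def gaussianNorm (σ : ℝ) (m : ℕ) : ℝ := (√(2 * Real.pi * σ ^ 2))⁻¹ ^ m

/-- The conditional law of the received signal given the input has density proportional to the
posterior weight of the input. -/
theorem map_received {m n : ℕ} {σ : ℝ} (hσ : 0 < σ) (A : Matrix (Fin m) (Fin n) ℝ)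
    (x : Fin n → Bool) :
    (noise m).map (received σ A x) = (volume : Measure (Fin m → ℝ)).withDensity fun y =>
      ENNReal.ofReal (gaussianNorm σ m * Real.exp (energy σ A y x)) := by
  have hv : (.mk (σ ^ 2) (sq_nonneg σ) : NNReal) ≠ 0 := by
    intro h
    have := congrArg NNReal.toReal h
    simp [hσ.ne'] at this
  have h1 : (noise m).map (received σ A x) = Measure.pi fun i : Fin m =>
      (gaussianReal 0 1).map fun t => A.mulVec (symbols x) i + σ * t :=
    Measure.pi_map_pi (f := fun i t => A.mulVec (symbols x) i + σ * t)
      fun i => by fun_prop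
  have h2 : ∀ i, ((gaussianReal 0 1).map fun t => A.mulVec (symbols x) i + σ * t)
      = (volume : Measure ℝ).withDensity fun t => ENNReal.ofReal
        (gaussianPDFReal (A.mulVec (symbols x) i) (.mk (σ ^ 2) (sq_nonneg σ)) t) := by
    intro i
    have : (fun t => A.mulVec (symbols x) i + σ * t)
        = (fun t => A.mulVec (symbols x) i + t) ∘ fun t => σ * t := rfl
    rw [this, ← Measure.map_map (by fun_prop) (by fun_prop), gaussianReal_map_const_mul,
      gaussianReal_map_const_add]
    simp only [mul_zero, zero_add, mul_one]
    exact gaussianReal_of_var_ne_zero _ hv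
  have hprob : ∀ i, IsProbabilityMeasure ((volume : Measure ℝ).withDensity fun t =>
      ENNReal.ofReal (gaussianPDFReal (A.mulVec (symbols x) i) (.mk (σ ^ 2) (sq_nonneg σ)) t)) := by
    intro i
    rw [← h2 i]
    exact Measure.isProbabilityMeasure_map (by fun_prop)
  rw [h1]
  simp only [h2]
  rw [pi_withDensity_ofReal
    (p := fun i => gaussianPDFReal (A.mulVec (symbols x) i) (.mk (σ ^ 2) (sq_nonneg σ)))
    (fun i => integrable_gaussianPDFReal _ _)
    fun i t => gaussianPDFReal_nonneg _ _ _]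
  congr 1
  funext y
  congr 1
  simp only [gaussianPDFReal, Finset.prod_mul_distrib, Finset.prod_const, Finset.card_univ,
    Fintype.card_fin, gaussianNorm, ← Real.exp_sum, energy, NNReal.coe_mk]
  congr 2
  rw [Finset.mul_sum]
  refine Finset.sum_congr rfl fun i _ => ?_
  ring

theorem measurable_received {m n : ℕ} (σ : ℝ) (A : Matrix (Fin m) (Fin n) ℝ) (x : Fin n → Bool) :
    Measurable (received σ A x) := by
  unfold received
  fun_prop

theorem continuous_energy {m n : ℕ} (σ : ℝ) (A : Matrix (Fin m) (Fin n) ℝ) :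
    Continuous (energy σ A) := by
  unfold energy
  fun_prop

theorem gaussianNorm_pos {σ : ℝ} (hσ : 0 < σ) (m : ℕ) : 0 < gaussianNorm σ m := by
  unfold gaussianNorm
  have := Real.pi_pos
  positivity

theorem integrable_comp_received_iff {m n : ℕ} {σ : ℝ} (hσ : 0 < σ)
    (A : Matrix (Fin m) (Fin n) ℝ) (x : Fin n → Bool) {g : (Fin m → ℝ) → ℝ} (hg : Measurable g) :
    Integrable (fun z => g (received σ A x z)) (noise m) ↔
      Integrable fun y => gaussianNorm σ m * Real.exp (energy σ A y x) * g y := by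
  have hc := (continuous_energy σ A).measurable
  have h := integrable_map_measure (μ := noise m) (f := received σ A x) (g := g)
    hg.aestronglyMeasurable (measurable_received σ A x).aemeasurable
  rw [Function.comp_def] at h
  rw [← h, map_received hσ, integrable_withDensity_iff_integrable_smul₀' (by fun_prop)
    (.of_forall fun y => ENNReal.ofReal_lt_top)]
  refine integrable_congr (.of_forall fun y => ?_)
  have := gaussianNorm_pos hσ m
  simp only [smul_eq_mul]
  rw [ENNReal.toReal_ofReal (by positivity)]

theorem integral_comp_received {m n : ℕ} {σ : ℝ} (hσ : 0 < σ)
    (A : Matrix (Fin m) (Fin n) ℝ) (x : Fin n → Bool) {g : (Fin m → ℝ) → ℝ} (hg : Measurable g) :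
    ∫ z, g (received σ A x z) ∂(noise m)
      = ∫ y, gaussianNorm σ m * Real.exp (energy σ A y x) * g y := by
  have hc := (continuous_energy σ A).measurable
  rw [← integral_map (measurable_received σ A x).aemeasurable hg.aestronglyMeasurable,
    map_received hσ, integral_withDensity_eq_integral_toReal_smul₀ (by fun_prop)
    (.of_forall fun y => ENNReal.ofReal_lt_top)]
  refine integral_congr_ae (.of_forall fun y => ?_)
  have := gaussianNorm_pos hσ m
  simp only [smul_eq_mul]
  rw [ENNReal.toReal_ofReal (by positivity)]

/-- **Nishimori identity**: given the received signal, a sample from the Gibbs measure (the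
posterior law of the input) and the true input are exchangeable. -/
theorem nishimori {m n : ℕ} {σ : ℝ} (hσ : 0 < σ) (A : Matrix (Fin m) (Fin n) ℝ)
    {k : (Fin m → ℝ) → (Fin n → Bool) → ℝ} (hk : Measurable k) (hk0 : ∀ y x, 0 ≤ k y x)
    (hki : ∀ x, Integrable (fun z => k (received σ A x z) x) (noise m)) :
    (∀ x₀, Integrable (fun z => gibbs (energy σ A (received σ A x₀ z)) (k (received σ A x₀ z)))
      (noise m)) ∧
    ∑ x₀, ∫ z, gibbs (energy σ A (received σ A x₀ z)) (k (received σ A x₀ z)) ∂(noise m)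
      = ∑ x, ∫ z, k (received σ A x z) x ∂(noise m) := by
  have hc := (continuous_energy σ A).measurable
  have hN := gaussianNorm_pos hσ m
  have hkx : ∀ x, Measurable fun y => k y x := fun x => (measurable_pi_apply x).comp hk
  have hG : Measurable fun y => gibbs (energy σ A y) (k y) := by
    unfold gibbs
    fun_prop
  have hI : ∀ x, Integrable fun y => gaussianNorm σ m * Real.exp (energy σ A y x) * k y x :=
    fun x => (integrable_comp_received_iff hσ A x (hkx x)).1 (hki x)
  have hsum : ∀ y, ∑ x₀, gaussianNorm σ m * Real.exp (energy σ A y x₀)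
      * gibbs (energy σ A y) (k y)
      = ∑ x, gaussianNorm σ m * Real.exp (energy σ A y x) * k y x := by
    intro y
    have hZ := sum_exp_pos (energy σ A y)
    rw [← Finset.sum_mul, ← Finset.mul_sum, gibbs]
    simp only [mul_assoc]
    rw [← Finset.mul_sum]
    congr 1
    field_simp
    exact Finset.sum_congr rfl fun x _ => mul_comm _ _
  have hterm : ∀ y x₀, 0 ≤ gaussianNorm σ m * Real.exp (energy σ A y x₀)
      * gibbs (energy σ A y) (k y) := fun y x₀ =>
    mul_nonneg (by positivity) (gibbs_nonneg _ (hk0 y))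
  -- each term is dominated by the sum over `x₀`, in which the partition function cancels
  have hJ : ∀ x₀, Integrable fun y => gaussianNorm σ m * Real.exp (energy σ A y x₀)
      * gibbs (energy σ A y) (k y) := by
    intro x₀
    refine (integrable_finsetSum Finset.univ fun x _ => hI x).mono'
      (Measurable.aestronglyMeasurable (by fun_prop)) (.of_forall fun y => ?_)
    rw [Real.norm_of_nonneg (hterm y x₀), ← hsum y]
    exact Finset.single_le_sum (fun x _ => hterm y x) (Finset.mem_univ x₀)
  refine ⟨fun x₀ => (integrable_comp_received_iff hσ A x₀ hG).2 (hJ x₀), ?_⟩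
  simp only [integral_comp_received hσ A _ hG]
  rw [← integral_finsetSum _ fun x _ => hJ x]
  simp only [hsum]
  rw [integral_finsetSum _ fun x _ => hI x]
  exact Finset.sum_congr rfl fun x _ => (integral_comp_received hσ A x (hkx x)).symm

theorem integrable_abs_pow_gaussian : Integrable (fun t : ℝ => |t| ^ 3) (gaussianReal 0 1) := by
  have h := (memLp_id_gaussianReal (μ := 0) (v := 1) 3).integrable_norm_pow (by norm_num)
  simpa using h

/-- The residual of a posterior sample has the third absolute moment of the noise, whatever the
signature matrix. -/
theorem average_gibbs_residual {m n : ℕ} {σ : ℝ} (hσ : 0 < σ) (A : Matrix (Fin m) (Fin n) ℝ)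
    (i : Fin m) :
    (∀ x₀, Integrable (fun z => gibbs (energy σ A (received σ A x₀ z))
      fun x => |received σ A x₀ z i - A.mulVec (symbols x) i| ^ 3) (noise m)) ∧
    (1 / 2 ^ n) * ∑ x₀, ∫ z, gibbs (energy σ A (received σ A x₀ z))
        (fun x => |received σ A x₀ z i - A.mulVec (symbols x) i| ^ 3) ∂(noise m)
      = σ ^ 3 * ∫ t, |t| ^ 3 ∂(gaussianReal 0 1) := by
  have e : ∀ (x : Fin n → Bool) z,
      |received σ A x z i - A.mulVec (symbols x) i| ^ 3 = σ ^ 3 * |z i| ^ 3 := by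
    intro x z
    rw [received, add_sub_cancel_left, abs_mul, abs_of_pos hσ, mul_pow]
  have hmp := measurePreserving_eval (fun _ : Fin m => gaussianReal 0 1) i
  have hint : Integrable (fun z : Fin m → ℝ => |z i| ^ 3) (noise m) :=
    hmp.integrable_comp_of_integrable integrable_abs_pow_gaussian
  obtain ⟨h1, h2⟩ := nishimori hσ A
    (k := fun y x => |y i - A.mulVec (symbols x) i| ^ 3) (by fun_prop) (fun y x => by positivity)
    (fun x => by simp only [e]; exact hint.const_mul _)
  refine ⟨h1, ?_⟩
  rw [h2]
  simp only [e]
  rw [integral_const_mul, integral_comp_eval (μ := fun _ : Fin m => gaussianReal 0 1)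
    (f := fun t : ℝ => |t| ^ 3) (by fun_prop)]
  simp

/-! ### Smoothness of the mean log-partition function in one entry -/

theorem abs_le_of_deriv_bound {g g' : ℝ → ℝ} {C : ℝ} {k : ℕ}
    (hg : ∀ t, HasDerivAt g (g' t) t) (h0 : g 0 = 0) (hC : 0 ≤ C)
    (hb : ∀ t, |g' t| ≤ C * |t| ^ k) (t : ℝ) : |g t| ≤ C * |t| ^ (k + 1) := by
  have h := Convex.norm_image_sub_le_of_norm_hasDerivWithin_le (f := g) (f' := g')
    (s := Set.uIcc 0 t) (C := C * |t| ^ k) (x := 0) (y := t)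
    (fun s _ => (hg s).hasDerivWithinAt) (fun s hs => ?_) (convex_uIcc 0 t) Set.left_mem_uIcc
    Set.right_mem_uIcc
  · simp only [h0, sub_zero, Real.norm_eq_abs] at h
    calc _ ≤ _ := h
      _ = _ := by ring
  · rw [Real.norm_eq_abs]
    have hst : |s| ≤ |t| := by
      have := Set.abs_sub_left_of_mem_uIcc hs
      simpa using this
    exact (hb s).trans (by gcongr)

/-- A function with bounded third derivative is quadratic up to a cubic error. -/
theorem exists_quadratic_approx {f f₁ f₂ f₃ : ℝ → ℝ} {L : ℝ}
    (h₁ : ∀ t, HasDerivAt f (f₁ t) t) (h₂ : ∀ t, HasDerivAt f₁ (f₂ t) t)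
    (h₃ : ∀ t, HasDerivAt f₂ (f₃ t) t) (hL : ∀ t, |f₃ t| ≤ L) :
    ∃ a b c : ℝ, ∀ t, |f t - (a + b * t + c * t ^ 2)| ≤ L * |t| ^ 3 := by
  have hL0 : 0 ≤ L := (abs_nonneg _).trans (hL 0)
  have e₂ : ∀ t, |f₂ t - f₂ 0| ≤ L * |t| ^ 1 :=
    abs_le_of_deriv_bound (g := fun t => f₂ t - f₂ 0) (k := 0)
      (fun t => (h₃ t).sub_const _) (by simp) hL0 (by simpa using hL)
  have e₁ : ∀ t, |f₁ t - f₁ 0 - f₂ 0 * t| ≤ L * |t| ^ 2 :=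
    abs_le_of_deriv_bound (g := fun t => f₁ t - f₁ 0 - f₂ 0 * t) (k := 1)
      (fun t => (((h₂ t).sub_const _).sub ((hasDerivAt_id t).const_mul (f₂ 0))).congr_deriv
        (by simp)) (by simp) hL0 e₂
  refine ⟨f 0, f₁ 0, f₂ 0 / 2, ?_⟩
  refine abs_le_of_deriv_bound
    (g := fun t => f t - (f 0 + f₁ 0 * t + f₂ 0 / 2 * t ^ 2)) (k := 2)
    (g' := fun t => f₁ t - f₁ 0 - f₂ 0 * t) (fun t => ?_) (by simp) hL0 e₁
  refine ((h₁ t).sub ((((hasDerivAt_id t).const_mul (f₁ 0)).const_add (f 0)).add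
    (((hasDerivAt_id t).pow 2).const_mul (f₂ 0 / 2)))).congr_deriv ?_
  simp
  ring

theorem memLp_eval_noise {m : ℕ} (i : Fin m) (p : NNReal) :
    MemLp (fun z : Fin m → ℝ => z i) p (noise m) :=
  (memLp_id_gaussianReal (μ := 0) (v := 1) p).comp_measurePreserving
    (measurePreserving_eval (fun _ : Fin m => gaussianReal 0 1) i)

section OneEntry

variable {ι : Type*} {m : ℕ} (σ : ℝ) (i : Fin m)
  (R : ι → (Fin m → ℝ) → ℝ) (w d : ι → ℝ)

/-- The energy as a function of the matrix entry `t`: `d` collects the coefficients of the entry,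
`w` the other terms of its row, and `R` the contribution of the other rows. -/
def entryEnergy (z : Fin m → ℝ) (x : ι) (t : ℝ) : ℝ :=
  -(1 / (2 * σ ^ 2)) * (R x z + (σ * z i + w x + t * d x) ^ 2)

/-- The derivative of `entryEnergy` in the entry. -/
def entryEnergy₁ (z : Fin m → ℝ) (x : ι) (t : ℝ) : ℝ :=
  -(1 / σ ^ 2) * (σ * z i + w x + t * d x) * d x

/-- The second derivative of `entryEnergy` in the entry, which is constant. -/
def entryEnergy₂ (x : ι) : ℝ := -(1 / σ ^ 2) * d x ^ 2

theorem hasDerivAt_entryEnergy (z : Fin m → ℝ) (x : ι) (t : ℝ) :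
    HasDerivAt (entryEnergy σ i R w d z x) (entryEnergy₁ σ i w d z x t) t := by
  have h : HasDerivAt (fun t => σ * z i + w x + t * d x) (d x) t := by
    simpa using ((hasDerivAt_id t).mul_const (d x)).const_add (σ * z i + w x)
  refine (((h.pow 2).const_add (R x z)).const_mul (-(1 / (2 * σ ^ 2)))).congr_deriv ?_
  unfold entryEnergy₁
  by_cases hσ : σ = 0
  · simp [hσ]
  · field_simp
    simp

theorem hasDerivAt_entryEnergy₁ (z : Fin m → ℝ) (x : ι) (t : ℝ) :
    HasDerivAt (entryEnergy₁ σ i w d z x) (entryEnergy₂ σ d x) t := by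
  have h : HasDerivAt (fun t => σ * z i + w x + t * d x) (d x) t := by
    simpa using ((hasDerivAt_id t).mul_const (d x)).const_add (σ * z i + w x)
  refine ((h.const_mul (-(1 / σ ^ 2))).mul_const (d x)).congr_deriv ?_
  unfold entryEnergy₂
  ring

variable {d} in
theorem abs_entryEnergy₂_le (hd : ∀ x, |d x| ≤ 2) (x : ι) :
    |entryEnergy₂ σ d x| ≤ 4 / σ ^ 2 := by
  unfold entryEnergy₂
  rw [abs_mul, abs_neg, abs_of_nonneg (by positivity : 0 ≤ 1 / σ ^ 2), abs_pow]
  have := pow_le_pow_left₀ (abs_nonneg (d x)) (hd x) 2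
  calc _ ≤ 1 / σ ^ 2 * 2 ^ 2 := by gcongr
    _ = _ := by ring

variable {d} in
theorem abs_entryEnergy₁_le (hd : ∀ x, |d x| ≤ 2) (z : Fin m → ℝ) (x : ι) (t : ℝ) :
    |entryEnergy₁ σ i w d z x t| ≤ 2 / σ ^ 2 * |σ * z i + w x + t * d x| := by
  unfold entryEnergy₁
  rw [abs_mul, abs_mul, abs_neg, abs_of_nonneg (by positivity : 0 ≤ 1 / σ ^ 2)]
  calc _ ≤ 1 / σ ^ 2 * |σ * z i + w x + t * d x| * 2 := by gcongr; exact hd x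
    _ = _ := by ring

/-- Differentiation under the Gaussian integral, three times, of the log-partition function as a
function of one entry. -/
theorem hasDerivAt_integral_logSumExp [Fintype ι] [Nonempty ι]
    (hR : ∀ x, Continuous (R x)) (hd : ∀ x, |d x| ≤ 2)
    (hint : ∀ t, Integrable
      (fun z => Real.log (∑ x, Real.exp (entryEnergy σ i R w d z x t))) (noise m)) (t : ℝ) :
    HasDerivAt (fun t => ∫ z, Real.log (∑ x, Real.exp (entryEnergy σ i R w d z x t)) ∂(noise m))
      (∫ z, gibbs (fun x => entryEnergy σ i R w d z x t)
        (fun x => entryEnergy₁ σ i w d z x t) ∂(noise m)) t ∧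
    HasDerivAt (fun t => ∫ z, gibbs (fun x => entryEnergy σ i R w d z x t)
        (fun x => entryEnergy₁ σ i w d z x t) ∂(noise m))
      (∫ z, logSumExpDeriv₂ (fun x => entryEnergy σ i R w d z x t)
        (fun x => entryEnergy₁ σ i w d z x t) (entryEnergy₂ σ d) ∂(noise m)) t ∧
    HasDerivAt (fun t => ∫ z, logSumExpDeriv₂ (fun x => entryEnergy σ i R w d z x t)
        (fun x => entryEnergy₁ σ i w d z x t) (entryEnergy₂ σ d) ∂(noise m))
      (∫ z, logSumExpDeriv₃ (fun x => entryEnergy σ i R w d z x t)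
        (fun x => entryEnergy₁ σ i w d z x t) (entryEnergy₂ σ d) ∂(noise m)) t ∧
    Integrable (fun z => logSumExpDeriv₃ (fun x => entryEnergy σ i R w d z x t)
        (fun x => entryEnergy₁ σ i w d z x t) (entryEnergy₂ σ d)) (noise m) := by
  have cE : ∀ t, Continuous fun z => fun x => entryEnergy σ i R w d z x t := by
    intro t; unfold entryEnergy; fun_prop
  have cE₁ : ∀ t, Continuous fun z => fun x => entryEnergy₁ σ i w d z x t := by
    intro t; unfold entryEnergy₁; fun_prop
  have cL : ∀ t, Continuous fun z =>
      Real.log (∑ x, Real.exp (entryEnergy σ i R w d z x t)) := fun t =>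
    Continuous.log (continuous_finsetSum _ fun x _ =>
      Real.continuous_exp.comp ((continuous_apply x).comp (cE t))) fun z => (sum_exp_pos _).ne'
  have c₁ : ∀ t, Continuous fun z => gibbs (fun x => entryEnergy σ i R w d z x t)
      (fun x => entryEnergy₁ σ i w d z x t) := fun t => continuous_gibbs (cE t) (cE₁ t)
  have c₂ := fun t => continuous_logSumExpDeriv₂ (entryEnergy₂ σ d) (cE t) (cE₁ t)
  have c₃ := fun t => continuous_logSumExpDeriv₃ (entryEnergy₂ σ d) (cE t) (cE₁ t)
  -- a common bound of the first derivatives of the energies for entries within distance `1` of `t`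
  set U : (Fin m → ℝ) → ℝ := fun z =>
    2 / σ ^ 2 * (|σ| * |z i| + (∑ x, |w x| + (|t| + 1) * 2)) with hUdef
  have hU : ∀ z, ∀ s ∈ Metric.ball t 1, ∀ x, |entryEnergy₁ σ i w d z x s| ≤ U z := by
    intro z s hs x
    refine (abs_entryEnergy₁_le σ i w hd z x s).trans ?_
    have hs' : |s| ≤ |t| + 1 := by
      rw [Metric.mem_ball, Real.dist_eq] at hs
      linarith [abs_sub_abs_le_abs_sub s t]
    have hw : |w x| ≤ ∑ x, |w x| :=
      Finset.single_le_sum (f := fun x => |w x|) (fun _ _ => abs_nonneg _) (Finset.mem_univ x)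
    have h1 : |σ * z i + w x + s * d x| ≤ |σ| * |z i| + |w x| + |s| * |d x| := by
      rw [← abs_mul, ← abs_mul]; exact abs_add_three _ _ _
    have h2 : |s| * |d x| ≤ (|t| + 1) * 2 :=
      mul_le_mul hs' (hd x) (abs_nonneg _) (by positivity)
    refine mul_le_mul_of_nonneg_left ?_ (by positivity)
    linarith
  have hUL : ∀ p : NNReal, MemLp U p (noise m) := fun p =>
    (((memLp_eval_noise i p).abs.const_mul |σ|).add (memLp_const _)).const_mul _
  have iU : Integrable U (noise m) := memLp_one_iff_integrable.1 (hUL 1)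
  have hU0 : ∀ z, 0 ≤ U z := fun z => by rw [hUdef]; positivity
  have iU₂ : Integrable (fun z => U z ^ 2) (noise m) := by
    have h := (hUL 2).integrable_norm_pow (by norm_num)
    simpa [abs_of_nonneg (hU0 _)] using h
  have iU₃ : Integrable (fun z => U z ^ 3) (noise m) := by
    have h := (hUL 3).integrable_norm_pow (by norm_num)
    simpa [abs_of_nonneg (hU0 _)] using h
  have hD := abs_entryEnergy₂_le σ hd
  set D := 4 / σ ^ 2
  have hball : Metric.ball t 1 ∈ 𝓝 t := Metric.ball_mem_nhds t one_pos
  have dE := fun z s x => hasDerivAt_entryEnergy σ i R w d z x s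
  have dE₁ := fun z s x => hasDerivAt_entryEnergy₁ σ i w d z x s
  have r₁ := hasDerivAt_integral_of_dominated_loc_of_deriv_le (μ := noise m) (x₀ := t)
    (F := fun t z => Real.log (∑ x, Real.exp (entryEnergy σ i R w d z x t)))
    (F' := fun t z => gibbs (fun x => entryEnergy σ i R w d z x t)
        (fun x => entryEnergy₁ σ i w d z x t)) (bound := U) hball
    (.of_forall fun s => (cL s).aestronglyMeasurable) (hint t) (c₁ t).aestronglyMeasurable
    (.of_forall fun z s hs => (abs_gibbs_le _ (hU z s hs)).trans (gibbs_const _ _).le) iU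
    (.of_forall fun z s _ => hasDerivAt_log_sum_exp (dE z s))
  have r₂ := hasDerivAt_integral_of_dominated_loc_of_deriv_le (μ := noise m) (x₀ := t)
    (F' := fun t z => logSumExpDeriv₂ (fun x => entryEnergy σ i R w d z x t)
        (fun x => entryEnergy₁ σ i w d z x t) (entryEnergy₂ σ d))
    (bound := fun z => D + 2 * U z ^ 2) hball
    (.of_forall fun s => (c₁ s).aestronglyMeasurable) r₁.1 (c₂ t).aestronglyMeasurable
    (.of_forall fun z s hs => abs_logSumExpDeriv₂_le _ hD (hU z s hs))
    ((integrable_const D).add (iU₂.const_mul 2))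
    (.of_forall fun z s _ => hasDerivAt_logSumExpDeriv₁ (dE z s) (dE₁ z s))
  have r₃ := hasDerivAt_integral_of_dominated_loc_of_deriv_le (μ := noise m) (x₀ := t)
    (F' := fun t z => logSumExpDeriv₃ (fun x => entryEnergy σ i R w d z x t)
        (fun x => entryEnergy₁ σ i w d z x t) (entryEnergy₂ σ d))
    (bound := fun z => 6 * D + (6 * D + 6) * U z ^ 3) hball
    (.of_forall fun s => (c₂ s).aestronglyMeasurable) r₂.1 (c₃ t).aestronglyMeasurable
    (.of_forall fun z s hs => abs_logSumExpDeriv₃_le_of_le _ hD (hU z s hs))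
    ((integrable_const _).add (iU₃.const_mul _))
    (.of_forall fun z s _ => hasDerivAt_logSumExpDeriv₂ (dE z s) (dE₁ z s))
  exact ⟨r₁.2, r₂.2, r₃.2, r₃.1⟩

end OneEntry

/-! ### The mean log-partition function of a matrix -/

/-- The mean log-partition function `E_Y log Z(Y)` as a function of the array of matrix entries. -/
def meanLogPartition {m n : ℕ} (σ : ℝ) (v : Fin m × Fin n → ℝ) : ℝ :=
  expectReceived σ (Matrix.of fun i j => v (i, j)) fun y =>
    Real.log (partitionFunction σ (Matrix.of fun i j => v (i, j)) y)

/-- All exponents are nonpositive, and the term of the true input `x` is `exp (-‖z‖² / 2)`: this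
bounds the log-partition function by an integrable function of the noise. -/
theorem abs_log_partitionFunction_le {m n : ℕ} {σ : ℝ} (hσ : 0 < σ)
    (A : Matrix (Fin m) (Fin n) ℝ) (x : Fin n → Bool) (z : Fin m → ℝ) :
    |Real.log (partitionFunction σ A (received σ A x z))|
      ≤ 1 / 2 * ∑ i, z i ^ 2 + n * Real.log 2 := by
  have hlow : -(1 / 2 * ∑ i, z i ^ 2) ≤ Real.log (partitionFunction σ A (received σ A x z)) := by
    have e : energy σ A (received σ A x z) x = -(1 / 2 * ∑ i, z i ^ 2) := by
      simp only [energy, received, add_sub_cancel_left, mul_pow]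
      rw [← Finset.mul_sum]
      field_simp
    rw [← e, partitionFunction_eq]
    refine (Real.le_log_iff_exp_le (sum_exp_pos _)).2 ?_
    exact Finset.single_le_sum (f := fun x' => Real.exp (energy σ A (received σ A x z) x'))
      (fun _ _ => (Real.exp_pos _).le) (Finset.mem_univ x)
  have hup : Real.log (partitionFunction σ A (received σ A x z)) ≤ n * Real.log 2 := by
    rw [← Real.log_pow, partitionFunction_eq]
    refine Real.log_le_log (sum_exp_pos _) ?_
    calc ∑ x', Real.exp (energy σ A (received σ A x z) x') ≤ ∑ _x' : Fin n → Bool, 1 := by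
          refine Finset.sum_le_sum fun x' _ => Real.exp_le_one_iff.2 ?_
          unfold energy
          rw [neg_mul, neg_nonpos]
          positivity
      _ = 2 ^ n := by simp
  have h1 : 0 ≤ n * Real.log 2 := by have := Real.log_nonneg one_le_two; positivity
  have h2 : 0 ≤ 1 / 2 * ∑ i, z i ^ 2 := by positivity
  rw [abs_le]
  constructor <;> linarith

theorem integrable_noise_bound (m n : ℕ) :
    Integrable (fun z : Fin m → ℝ => 1 / 2 * ∑ i, z i ^ 2 + n * Real.log 2) (noise m) := by
  refine Integrable.add (Integrable.const_mul (integrable_finsetSum _ fun i _ => ?_) _)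
    (integrable_const _)
  exact (memLp_eval_noise i 2).integrable_sq

theorem continuous_log_partitionFunction {m n : ℕ} (σ : ℝ) (x : Fin n → Bool) :
    Continuous fun p : (Fin m × Fin n → ℝ) × (Fin m → ℝ) =>
      Real.log (partitionFunction σ (Matrix.of fun i j => p.1 (i, j))
        (received σ (Matrix.of fun i j => p.1 (i, j)) x p.2)) := by
  refine Continuous.log ?_ fun p => (sum_exp_pos _).ne'
  simp only [partitionFunction, received, Matrix.mulVec, dotProduct, Matrix.of_apply]
  fun_prop

theorem integrable_log_partitionFunction {m n : ℕ} {σ : ℝ} (hσ : 0 < σ)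
    (A : Matrix (Fin m) (Fin n) ℝ) (x : Fin n → Bool) :
    Integrable (fun z => Real.log (partitionFunction σ A (received σ A x z))) (noise m) := by
  have hc := (continuous_log_partitionFunction (m := m) σ x).comp
    (Continuous.prodMk_right fun q : Fin m × Fin n => A q.1 q.2)
  exact (integrable_noise_bound m n).mono' hc.aestronglyMeasurable
    (.of_forall fun z => abs_log_partitionFunction_le hσ A x z)

theorem abs_meanLogPartition_le {m n : ℕ} {σ : ℝ} (hσ : 0 < σ) (v : Fin m × Fin n → ℝ) :
    |meanLogPartition σ v|
      ≤ ∫ z : Fin m → ℝ, (1 / 2 * ∑ i, z i ^ 2 + n * Real.log 2) ∂(noise m) := by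
  unfold meanLogPartition expectReceived
  rw [abs_mul, abs_of_nonneg (by positivity), one_div, inv_mul_le_iff₀ (by positivity)]
  refine (Finset.abs_sum_le_sum_abs _ _).trans ?_
  have h : ∀ x, |∫ z, Real.log (partitionFunction σ (Matrix.of fun i j => v (i, j))
      (received σ (Matrix.of fun i j => v (i, j)) x z)) ∂(noise m)|
      ≤ ∫ z : Fin m → ℝ, (1 / 2 * ∑ i, z i ^ 2 + n * Real.log 2) ∂(noise m) := fun x => by
    rw [← Real.norm_eq_abs]
    exact norm_integral_le_of_norm_le (integrable_noise_bound m n)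
      (.of_forall fun z => abs_log_partitionFunction_le hσ _ x z)
  refine (Finset.sum_le_sum fun x _ => h x).trans ?_
  simp

theorem measurable_meanLogPartition {m n : ℕ} (σ : ℝ) :
    Measurable (meanLogPartition σ : (Fin m × Fin n → ℝ) → ℝ) := by
  unfold meanLogPartition expectReceived
  refine Measurable.const_mul (Finset.measurable_sum _ fun x _ => ?_) _
  exact ((continuous_log_partitionFunction σ x).stronglyMeasurable.integral_prod_right'
    (ν := noise m)).measurable

theorem mulVec_update {m n : ℕ} (M : Fin m × Fin n → ℝ) (i : Fin m) (j : Fin n) (t : ℝ)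
    (s : Fin n → ℝ) (k : Fin m) :
    (Matrix.of fun a b => Function.update M (i, j) t (a, b)).mulVec s k
      = (Matrix.of fun a b => Function.update M (i, j) 0 (a, b)).mulVec s k
        + if k = i then t * s j else 0 := by
  have e : ∀ l, Function.update M (i, j) t (k, l) * s l
      = Function.update M (i, j) 0 (k, l) * s l
        + if l = j then (if k = i then t * s j else 0) else 0 := by
    intro l
    by_cases hl : l = j
    · subst hl
      by_cases hk : k = i
      · subst hk; simp
      · simp [hk]
    · simp [hl]
  simp only [Matrix.mulVec, dotProduct, Matrix.of_apply, e]
  rw [Finset.sum_add_distrib]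
  simp

theorem abs_symbols_sub_le {n : ℕ} (x y : Fin n → Bool) (j : Fin n) :
    |symbols x j - symbols y j| ≤ 2 := by
  unfold symbols symbol
  cases x j <;> cases y j <;> norm_num

/-- A bound, uniform over all matrices, of the third derivative of the mean log-partition function
in one entry. -/
def thirdDerivBound (σ : ℝ) : ℝ :=
  6 * (4 / σ ^ 2) + (6 * (4 / σ ^ 2) + 6) * (2 / σ ^ 2) ^ 3
    * (σ ^ 3 * ∫ t, |t| ^ 3 ∂(gaussianReal 0 1))

theorem thirdDerivBound_nonneg {σ : ℝ} (hσ : 0 < σ) : 0 ≤ thirdDerivBound σ := by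
  unfold thirdDerivBound
  have : 0 ≤ ∫ t, |t| ^ 3 ∂(gaussianReal 0 1) := integral_nonneg fun t => by positivity
  positivity

theorem meanLogPartition_quadratic_approx {m n : ℕ} {σ : ℝ} (hσ : 0 < σ)
    (M : Fin m × Fin n → ℝ) (q : Fin m × Fin n) :
    ∃ a b c : ℝ, ∀ t, |meanLogPartition σ (Function.update M q t) - (a + b * t + c * t ^ 2)|
      ≤ thirdDerivBound σ * |t| ^ 3 := by
  obtain ⟨i, j⟩ := q
  let A : ℝ → Matrix (Fin m) (Fin n) ℝ := fun t =>
    Matrix.of fun a b => Function.update M (i, j) t (a, b)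
  let W : (Fin n → Bool) → (Fin n → Bool) → Fin m → ℝ := fun x₀ x k =>
    (A 0).mulVec (symbols x₀) k - (A 0).mulVec (symbols x) k
  let d : (Fin n → Bool) → (Fin n → Bool) → ℝ := fun x₀ x => symbols x₀ j - symbols x j
  let R : (Fin n → Bool) → (Fin n → Bool) → (Fin m → ℝ) → ℝ := fun x₀ x z =>
    ∑ k ∈ Finset.univ.erase i, (σ * z k + W x₀ x k) ^ 2
  have hres : ∀ t x₀ x z k, received σ (A t) x₀ z k - (A t).mulVec (symbols x) k
      = σ * z k + W x₀ x k + if k = i then t * d x₀ x else 0 := by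
    intro t x₀ x z k
    simp only [received, A, mulVec_update M i j t, W, d]
    split_ifs <;> ring
  have hen : ∀ t x₀ x z, energy σ (A t) (received σ (A t) x₀ z) x
      = entryEnergy σ i (R x₀) (fun x => W x₀ x i) (d x₀) z x t := by
    intro t x₀ x z
    simp only [energy, entryEnergy, hres, R]
    rw [← Finset.add_sum_erase _ _ (Finset.mem_univ i), add_comm]
    congr 2
    · refine Finset.sum_congr rfl fun k hk => ?_
      rw [if_neg (Finset.ne_of_mem_erase hk), add_zero]
    · simp
  have hint : ∀ x₀ t, Integrable (fun z => Real.log (∑ x, Real.exp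
      (entryEnergy σ i (R x₀) (fun x => W x₀ x i) (d x₀) z x t))) (noise m) := by
    intro x₀ t
    have h := integrable_log_partitionFunction hσ (A t) x₀
    simpa only [partitionFunction_eq, hen] using h
  have hd : ∀ x₀ x, |d x₀ x| ≤ 2 := fun x₀ x => abs_symbols_sub_le x₀ x j
  have hR : ∀ x₀ x, Continuous (R x₀ x) := by
    intro x₀ x; simp only [R]; fun_prop
  have key := fun x₀ => hasDerivAt_integral_logSumExp σ i (R x₀) (fun x => W x₀ x i) (d x₀)
    (hR x₀) (hd x₀) (hint x₀)
  have hF : (fun t => meanLogPartition σ (Function.update M (i, j) t)) = fun t =>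
      (1 / 2 ^ n) * ∑ x₀, ∫ z, Real.log (∑ x, Real.exp
        (entryEnergy σ i (R x₀) (fun x => W x₀ x i) (d x₀) z x t)) ∂(noise m) := by
    funext t
    have : meanLogPartition σ (Function.update M (i, j) t)
      = (1 / 2 ^ n) * ∑ x₀, ∫ z, Real.log (partitionFunction σ (A t) (received σ (A t) x₀ z))
        ∂(noise m) := rfl
    rw [this]
    simp only [partitionFunction_eq, hen]
  refine exists_quadratic_approx (f := fun t => meanLogPartition σ (Function.update M (i, j) t))
    (fun t => hF ▸ (HasDerivAt.fun_sum fun x₀ _ => (key x₀ t).1).const_mul _)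
    (fun t => (HasDerivAt.fun_sum fun x₀ _ => (key x₀ t).2.1).const_mul _)
    (fun t => (HasDerivAt.fun_sum fun x₀ _ => (key x₀ t).2.2.1).const_mul _) fun t => ?_
  -- the third derivative: the Nishimori identity makes the bound uniform in the matrix
  obtain ⟨hg, hs⟩ := average_gibbs_residual hσ (A t) i
  set D := 4 / σ ^ 2
  set κ := (6 * D + 6) * (2 / σ ^ 2) ^ 3 with hκ
  have hpt : ∀ x₀ z, ‖logSumExpDeriv₃
      (fun x => entryEnergy σ i (R x₀) (fun x => W x₀ x i) (d x₀) z x t)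
      (fun x => entryEnergy₁ σ i (fun x => W x₀ x i) (d x₀) z x t) (entryEnergy₂ σ (d x₀))‖
      ≤ 6 * D + κ * gibbs (energy σ (A t) (received σ (A t) x₀ z))
        (fun x => |received σ (A t) x₀ z i - (A t).mulVec (symbols x) i| ^ 3) := by
    intro x₀ z
    refine (abs_logSumExpDeriv₃_le
      (fun x => entryEnergy σ i (R x₀) (fun x => W x₀ x i) (d x₀) z x t)
      (h := fun x => entryEnergy₁ σ i (fun x => W x₀ x i) (d x₀) z x t)
      (abs_entryEnergy₂_le σ (hd x₀))).trans ?_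
    rw [hκ, mul_assoc, ← gibbs_const_mul _ _ ((2 / σ ^ 2) ^ 3)]
    have he : energy σ (A t) (received σ (A t) x₀ z)
        = fun x => entryEnergy σ i (R x₀) (fun x => W x₀ x i) (d x₀) z x t :=
      funext fun x => hen t x₀ x z
    rw [he]
    gcongr
    refine gibbs_mono (ι := Fin n → Bool) _ fun x => ?_
    rw [← mul_pow, hres, if_pos rfl]
    exact pow_le_pow_left₀ (abs_nonneg _) (abs_entryEnergy₁_le σ i _ (hd x₀) z x t) 3
  rw [abs_mul, abs_of_nonneg (by positivity)]
  calc _ ≤ 1 / 2 ^ n * ∑ x₀, (6 * D + κ *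
        ∫ z, gibbs (energy σ (A t) (received σ (A t) x₀ z))
          (fun x => |received σ (A t) x₀ z i - (A t).mulVec (symbols x) i| ^ 3) ∂(noise m)) := by
        gcongr
        refine (Finset.abs_sum_le_sum_abs _ _).trans (Finset.sum_le_sum fun x₀ _ => ?_)
        refine (norm_integral_le_of_norm_le
          ((integrable_const _).add ((hg x₀).const_mul _)) (.of_forall (hpt x₀))).trans ?_
        simp only [Pi.add_apply]
        rw [integral_add (integrable_const _) ((hg x₀).const_mul _), integral_const_mul κ]
        simp
    _ = thirdDerivBound σ := by
        have h3 : thirdDerivBound σ = 6 * D + κ * (σ ^ 3 * ∫ t, |t| ^ 3 ∂(gaussianReal 0 1)) := rfl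
        rw [Finset.sum_add_distrib, ← Finset.mul_sum _ _ κ, mul_add, h3, ← hs]
        simp only [Finset.sum_const, Finset.card_univ, Fintype.card_pi, Fintype.card_bool,
          Finset.prod_const, Fintype.card_fin, nsmul_eq_mul]
        push_cast
        field_simp

/-! ### The laws of the dense and the sparsified matrices -/

/-- Integrals of affine functions of the mean log-partition function, as the capacity is one. -/
theorem integral_affine_meanLogPartition {m n : ℕ} {σ : ℝ} (hσ : 0 < σ) {Ω : Type*}
    [MeasurableSpace Ω] {P : Measure Ω} [IsProbabilityMeasure P] {V : Ω → Fin m × Fin n → ℝ}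
    (hV : Measurable V) (a b : ℝ) :
    ∫ ω, (a - b * meanLogPartition σ (V ω)) ∂P = a - b * ∫ v, meanLogPartition σ v ∂(P.map V) := by
  have hF := measurable_meanLogPartition (m := m) (n := n) σ
  have hi : Integrable (fun ω => meanLogPartition σ (V ω)) P :=
    Integrable.of_bound (hF.comp hV).aestronglyMeasurable _
      (.of_forall fun ω => abs_meanLogPartition_le hσ _)
  rw [integral_sub (integrable_const a) (hi.const_mul b), integral_const_mul,
    integral_map hV.aemeasurable hF.aestronglyMeasurable]
  simp

/-- The law of an entry of the sparsified and rescaled matrix: an entry with law `μ` is kept with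
probability `p`, otherwise replaced by `0`, and multiplied by `c`. -/
def sparseEntryLaw (μ : Measure ℝ) (p : unitInterval) (c : ℝ) : Measure ℝ :=
  (μ.prod (bernoulliMeasure true false p)).map fun q => c * if q.2 then q.1 else 0

theorem measurable_sparseEntry (c : ℝ) :
    Measurable fun q : ℝ × Bool => c * if q.2 then q.1 else 0 := by
  refine Measurable.const_mul (Measurable.ite ?_ measurable_fst measurable_const) c
  exact measurable_snd (measurableSet_singleton true)

instance (μ : Measure ℝ) [IsProbabilityMeasure μ] (p : unitInterval) (c : ℝ) :
    IsProbabilityMeasure (sparseEntryLaw μ p c) :=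
  Measure.isProbabilityMeasure_map (measurable_sparseEntry c).aemeasurable

theorem integral_sparseEntryLaw {μ : Measure ℝ} [IsProbabilityMeasure μ] (p : unitInterval)
    (c : ℝ) {φ : ℝ → ℝ} (hφ : Measurable φ) (h0 : φ 0 = 0)
    (hi : Integrable (fun a => φ (c * a)) μ) :
    Integrable φ (sparseEntryLaw μ p c) ∧
      ∫ t, φ t ∂(sparseEntryLaw μ p c) = p * ∫ a, φ (c * a) ∂μ := by
  have e : (fun q : ℝ × Bool => φ (c * if q.2 then q.1 else 0))
      = fun q => φ (c * q.1) * if q.2 then 1 else 0 := by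
    funext q
    cases q.2 <;> simp [h0]
  have hb : Integrable (fun b : Bool => if b then (1 : ℝ) else 0)
      (bernoulliMeasure true false p) := .of_finite
  have hm := (measurable_sparseEntry c).aemeasurable
    (μ := μ.prod (bernoulliMeasure true false p))
  constructor
  · rw [sparseEntryLaw, integrable_map_measure hφ.aestronglyMeasurable hm, Function.comp_def, e]
    exact hi.mul_prod hb
  · rw [sparseEntryLaw, integral_map hm hφ.aestronglyMeasurable, e,
      integral_prod_mul (fun a => φ (c * a)) (fun b : Bool => if b then (1 : ℝ) else 0),
      integral_bernoulliMeasure]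
    simp [mul_comm]

section Laws

variable {m n : ℕ} {Ω : Type*} [MeasurableSpace Ω] {P : Measure Ω} [IsProbabilityMeasure P]
  {A : Ω → Matrix (Fin m) (Fin n) ℝ}

theorem denseCapacity_eq {σ : ℝ} (hσ : 0 < σ) (hA : ∀ i j, Measurable fun ω => A ω i j)
    (hind : iIndepFun (fun (q : Fin m × Fin n) ω => A ω q.1 q.2) P) :
    denseCapacity σ P A = Real.log 2 - 1 / 2 * ((m : ℝ) / n) - 1 / n *
      ∫ v, meanLogPartition σ v ∂(Measure.pi fun q : Fin m × Fin n =>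
        P.map fun ω => (√n)⁻¹ * A ω q.1 q.2) := by
  have hA' : ∀ q : Fin m × Fin n, Measurable fun ω => A ω q.1 q.2 := fun q => hA _ _
  have hlaw : P.map (fun ω (q : Fin m × Fin n) => (√n)⁻¹ * A ω q.1 q.2)
      = Measure.pi fun q : Fin m × Fin n => P.map fun ω => (√n)⁻¹ * A ω q.1 q.2 := by
    have h2 := hind.comp (fun _ t => (√n)⁻¹ * t) fun _ => by fun_prop
    exact (iIndepFun_iff_map_fun_eq_pi_map fun q => by fun_prop).1 h2
  have e : ∀ ω, capacity σ ((√n)⁻¹ • A ω) = Real.log 2 - 1 / 2 * ((m : ℝ) / n)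
      - 1 / n * meanLogPartition σ fun q => (√n)⁻¹ * A ω q.1 q.2 := fun ω => rfl
  rw [← hlaw, denseCapacity]
  simp only [e]
  exact integral_affine_meanLogPartition hσ (by fun_prop) _ _

/-- The entries of the sparsified matrix are independent: their joint law is the product of the
laws of the masked and rescaled entries. -/
theorem sparseCapacity_eq {σ : ℝ} (hσ : 0 < σ) (γ : ℝ) (hA : ∀ i j, Measurable fun ω => A ω i j)
    (hind : iIndepFun (fun (q : Fin m × Fin n) ω => A ω q.1 q.2) P) :
    sparseCapacity σ γ P A = Real.log 2 - 1 / 2 * ((m : ℝ) / n) - 1 / n *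
      ∫ v, meanLogPartition σ v ∂(Measure.pi fun q : Fin m × Fin n =>
        sparseEntryLaw (P.map fun ω => A ω q.1 q.2)
          (Set.projIcc (0 : ℝ) 1 zero_le_one (γ / n)) (√γ)⁻¹) := by
  set p := Set.projIcc (0 : ℝ) 1 zero_le_one (γ / n) with hp
  have hA' : ∀ q : Fin m × Fin n, Measurable fun ω => A ω q.1 q.2 := fun q => hA _ _
  have hV : Measurable fun ω (q : Fin m × Fin n) => A ω q.1 q.2 := by fun_prop
  have hprob : ∀ q : Fin m × Fin n, IsProbabilityMeasure (P.map fun ω => A ω q.1 q.2) :=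
    fun q => Measure.isProbabilityMeasure_map (hA' q).aemeasurable
  have hlaw : P.map (fun ω (q : Fin m × Fin n) => A ω q.1 q.2)
      = Measure.pi fun q : Fin m × Fin n => P.map fun ω => A ω q.1 q.2 :=
    (iIndepFun_iff_map_fun_eq_pi_map fun q => (hA' q).aemeasurable).1 hind
  let G : Ω × (Fin m × Fin n → Bool) → Fin m × Fin n → ℝ := fun r q =>
    (√γ)⁻¹ * if r.2 q then A r.1 q.1 q.2 else 0
  have hG : Measurable G := by
    refine measurable_pi_lambda _ fun q => (measurable_sparseEntry (√γ)⁻¹).comp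
      (g := fun q : ℝ × Bool => (√γ)⁻¹ * if q.2 then q.1 else 0)
      (f := fun r : Ω × (Fin m × Fin n → Bool) => (A r.1 q.1 q.2, r.2 q)) ?_
    exact ((hA' q).comp measurable_fst).prodMk ((measurable_pi_apply q).comp measurable_snd)
  have hlawG : (P.prod (maskLaw γ m n)).map G = Measure.pi fun q : Fin m × Fin n =>
        sparseEntryLaw (P.map fun ω => A ω q.1 q.2) p (√γ)⁻¹ := by
    have hmp := (measurePreserving_arrowProdEquivProdArrow ℝ Bool (Fin m × Fin n)
      (fun q => P.map fun ω => A ω q.1 q.2) fun _ => bernoulliMeasure true false p).symm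
    have e1 : (P.prod (maskLaw γ m n)).map
        (Prod.map (fun ω (q : Fin m × Fin n) => A ω q.1 q.2) id)
        = (Measure.pi fun q : Fin m × Fin n => P.map fun ω => A ω q.1 q.2).prod
          (Measure.pi fun _ : Fin m × Fin n => bernoulliMeasure true false p) := by
      rw [← Measure.map_prod_map _ _ hV measurable_id, hlaw, Measure.map_id, maskLaw]
    have e2 := Measure.pi_map_pi
      (μ := fun q : Fin m × Fin n =>
        (P.map fun ω => A ω q.1 q.2).prod (bernoulliMeasure true false p))
      (f := fun _ (q : ℝ × Bool) => (√γ)⁻¹ * if q.2 then q.1 else 0)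
      fun _ => (measurable_sparseEntry (√γ)⁻¹).aemeasurable
    have hmf : Measurable fun (r : Fin m × Fin n → ℝ × Bool) q =>
        (√γ)⁻¹ * if (r q).2 then (r q).1 else 0 :=
      measurable_pi_lambda _ fun q => (measurable_sparseEntry (√γ)⁻¹).comp (measurable_pi_apply q)
    simp only [sparseEntryLaw]
    rw [← e2, ← hmp.map_eq, ← e1, Measure.map_map hmp.measurable (hV.prodMap measurable_id),
      Measure.map_map hmf (hmp.measurable.comp (hV.prodMap measurable_id))]
    rfl
  have hmask : IsProbabilityMeasure (maskLaw γ m n) := by unfold maskLaw; infer_instance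
  have e : ∀ r : Ω × (Fin m × Fin n → Bool), capacity σ ((√γ)⁻¹ • keep (A r.1) r.2)
      = Real.log 2 - 1 / 2 * ((m : ℝ) / n) - 1 / n * meanLogPartition σ (G r) := fun r => rfl
  rw [← hlawG, sparseCapacity]
  simp only [e]
  exact integral_affine_meanLogPartition hσ hG _ _

end Laws

/-! ### Comparison of the two capacities -/

theorem integrable_abs_pow_three {Ω : Type*} [MeasurableSpace Ω] {P : Measure Ω}
    [IsProbabilityMeasure P] {X : Ω → ℝ} (hX : Measurable X) {K : ℝ}
    (h6 : Integrable (fun ω => X ω ^ 6) P) (hK : ∫ ω, X ω ^ 6 ∂P ≤ K) :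
    Integrable (fun ω => |X ω| ^ 3) P ∧ ∫ ω, |X ω| ^ 3 ∂P ≤ 1 + K := by
  have hle : ∀ ω, |X ω| ^ 3 ≤ 1 + X ω ^ 6 := by
    intro ω
    have : X ω ^ 6 = (|X ω| ^ 3) ^ 2 := by
      rw [← pow_mul, Even.pow_abs (by decide)]
    rw [this]
    nlinarith [sq_nonneg (|X ω| ^ 3 - 1), sq_nonneg (|X ω| ^ 3)]
  have hi : Integrable (fun ω => 1 + X ω ^ 6) P := (integrable_const 1).add h6
  have h3 : Integrable (fun ω => |X ω| ^ 3) P := by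
    refine hi.mono' (by fun_prop) (.of_forall fun ω => ?_)
    rw [Real.norm_of_nonneg (by positivity)]
    exact hle ω
  refine ⟨h3, (integral_mono h3 hi hle).trans ?_⟩
  rw [integral_add (integrable_const 1) h6]
  simpa using hK

/-- Integrability of the square is implied by the second moment being `1`, as the integral of a
non-integrable function is `0` by convention. -/
theorem integrable_sq_of_integral_eq_one {Ω : Type*} [MeasurableSpace Ω] {P : Measure Ω}
    {X : Ω → ℝ} (h : ∫ ω, X ω ^ 2 ∂P = 1) : Integrable (fun ω => X ω ^ 2) P := by
  by_contra h'
  rw [integral_undef h'] at h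
  exact zero_ne_one h

/-- The non-asymptotic form of the equivalence, from the Lindeberg exchange of all the entries. -/
theorem abs_sparseCapacity_sub_denseCapacity_le {m n : ℕ} {σ γ : ℝ} (hσ : 0 < σ) (hγ : 0 < γ)
    (hγn : γ ≤ n) {Ω Ω' : Type*} [MeasurableSpace Ω] [MeasurableSpace Ω'] {P : Measure Ω}
    [IsProbabilityMeasure P] {Q : Measure Ω'} [IsProbabilityMeasure Q]
    {A : Ω → Matrix (Fin m) (Fin n) ℝ} {B : Ω' → Matrix (Fin m) (Fin n) ℝ}
    (hA : ∀ i j, Measurable fun ω => A ω i j)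
    (hAi : iIndepFun (fun (q : Fin m × Fin n) ω => A ω q.1 q.2) P)
    (hA1 : ∀ i j, ∫ ω, A ω i j ∂P = 0) (hA2 : ∀ i j, ∫ ω, A ω i j ^ 2 ∂P = 1)
    {K : ℝ} (hA6 : ∀ i j, Integrable (fun ω => A ω i j ^ 6) P ∧ ∫ ω, A ω i j ^ 6 ∂P ≤ K)
    (hB : ∀ i j, Measurable fun ω => B ω i j)
    (hBi : iIndepFun (fun (q : Fin m × Fin n) ω => B ω q.1 q.2) Q)
    (hB1 : ∀ i j, ∫ ω, B ω i j ∂Q = 0) (hB2 : ∀ i j, ∫ ω, B ω i j ^ 2 ∂Q = 1)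
    {K' : ℝ} (hB6 : ∀ i j, Integrable (fun ω => B ω i j ^ 6) Q ∧ ∫ ω, B ω i j ^ 6 ∂Q ≤ K') :
    |sparseCapacity σ γ P A - denseCapacity σ Q B|
      ≤ (m : ℝ) / n * (thirdDerivBound σ * ((√γ)⁻¹ * (1 + K) + (√n)⁻¹ * (1 + K'))) := by
  have hn : (0 : ℝ) < n := hγ.trans_le hγn
  set p := Set.projIcc (0 : ℝ) 1 zero_le_one (γ / n) with hp
  have hpv : (p : ℝ) = γ / n := by
    rw [hp, Set.projIcc_of_mem]
    exact ⟨by positivity, (div_le_one hn).2 hγn⟩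
  have hcγ : ((√γ)⁻¹) ^ 2 = γ⁻¹ := by rw [inv_pow, Real.sq_sqrt hγ.le]
  have hcn : ((√(n : ℝ))⁻¹) ^ 2 = (n : ℝ)⁻¹ := by rw [inv_pow, Real.sq_sqrt hn.le]
  -- moments of the entries of the sparsified matrix: `E φ = (γ / n) E φ(γ^{-1/2} A)` if `φ 0 = 0`
  have hAm : ∀ q : Fin m × Fin n, Measurable fun ω => A ω q.1 q.2 := fun q => hA _ _
  have hApr : ∀ q : Fin m × Fin n, IsProbabilityMeasure (P.map fun ω => A ω q.1 q.2) :=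
    fun q => Measure.isProbabilityMeasure_map (hAm q).aemeasurable
  have sA : ∀ (q : Fin m × Fin n) (φ : ℝ → ℝ), Measurable φ → φ 0 = 0 →
      Integrable (fun ω => φ ((√γ)⁻¹ * A ω q.1 q.2)) P →
      Integrable φ (sparseEntryLaw (P.map fun ω => A ω q.1 q.2) p (√γ)⁻¹) ∧
      ∫ t, φ t ∂(sparseEntryLaw (P.map fun ω => A ω q.1 q.2) p (√γ)⁻¹)
        = γ / n * ∫ ω, φ ((√γ)⁻¹ * A ω q.1 q.2) ∂P := by
    intro q φ hφ h0 hi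
    have hφ' : Measurable fun a => φ ((√γ)⁻¹ * a) := by fun_prop
    have h := integral_sparseEntryLaw (μ := P.map fun ω => A ω q.1 q.2) p (√γ)⁻¹ hφ h0
      ((integrable_map_measure hφ'.aestronglyMeasurable (hAm q).aemeasurable).2 hi)
    rwa [hpv, integral_map (hAm q).aemeasurable hφ'.aestronglyMeasurable] at h
  have iA2 := fun q : Fin m × Fin n => integrable_sq_of_integral_eq_one (hA2 q.1 q.2)
  have iA1 : ∀ q : Fin m × Fin n, Integrable (fun ω => A ω q.1 q.2) P := fun q =>
    ((memLp_two_iff_integrable_sq (hAm q).aestronglyMeasurable).2 (iA2 q)).integrable one_le_two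
  have iA3 := fun q : Fin m × Fin n =>
    integrable_abs_pow_three (hAm q) (hA6 q.1 q.2).1 (hA6 q.1 q.2).2
  have mA1 := fun q => sA q (fun t => t) measurable_id rfl ((iA1 q).const_mul _)
  have mA2 := fun q => sA q (fun t => t ^ 2) (by fun_prop) (by simp) (by
    simp only [mul_pow]; exact (iA2 q).const_mul _)
  have mA3 := fun q => sA q (fun t => |t| ^ 3) (by fun_prop) (by simp) (by
    simp only [abs_mul, mul_pow]; exact (iA3 q).1.const_mul _)
  -- moments of the entries of the dense matrix
  have hBm : ∀ q : Fin m × Fin n, Measurable fun ω => B ω q.1 q.2 := fun q => hB _ _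
  have hBpr : ∀ q : Fin m × Fin n,
      IsProbabilityMeasure (Q.map fun ω => (√n)⁻¹ * B ω q.1 q.2) :=
    fun q => Measure.isProbabilityMeasure_map (by fun_prop)
  have sB : ∀ (q : Fin m × Fin n) (φ : ℝ → ℝ), Measurable φ →
      Integrable (fun ω => φ ((√n)⁻¹ * B ω q.1 q.2)) Q →
      Integrable φ (Q.map fun ω => (√n)⁻¹ * B ω q.1 q.2) ∧
      ∫ t, φ t ∂(Q.map fun ω => (√n)⁻¹ * B ω q.1 q.2)
        = ∫ ω, φ ((√n)⁻¹ * B ω q.1 q.2) ∂Q := by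
    intro q φ hφ hi
    exact ⟨(integrable_map_measure hφ.aestronglyMeasurable (by fun_prop)).2 hi,
      integral_map (by fun_prop) hφ.aestronglyMeasurable⟩
  have iB2 := fun q : Fin m × Fin n => integrable_sq_of_integral_eq_one (hB2 q.1 q.2)
  have iB1 : ∀ q : Fin m × Fin n, Integrable (fun ω => B ω q.1 q.2) Q := fun q =>
    ((memLp_two_iff_integrable_sq (hBm q).aestronglyMeasurable).2 (iB2 q)).integrable one_le_two
  have iB3 := fun q : Fin m × Fin n =>
    integrable_abs_pow_three (hBm q) (hB6 q.1 q.2).1 (hB6 q.1 q.2).2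
  have mB1 := fun q => sB q (fun t => t) measurable_id ((iB1 q).const_mul _)
  have mB2 := fun q => sB q (fun t => t ^ 2) (by fun_prop) (by
    simp only [mul_pow]; exact (iB2 q).const_mul _)
  have mB3 := fun q => sB q (fun t => |t| ^ 3) (by fun_prop) (by
    simp only [abs_mul, mul_pow]; exact (iB3 q).1.const_mul _)
  have key := lindeberg_exchange (measurable_meanLogPartition (m := m) (n := n) σ)
    (abs_meanLogPartition_le hσ) (thirdDerivBound_nonneg hσ)
    (meanLogPartition_quadratic_approx hσ)
    (fun q => (mA1 q).1) (fun q => (mB1 q).1) (fun q => (mA2 q).1) (fun q => (mB2 q).1)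
    (fun q => (mA3 q).1) (fun q => (mB3 q).1)
    (fun q => by
      rw [(mA1 q).2, (mB1 q).2, integral_const_mul, integral_const_mul, hA1, hB1]; simp)
    (fun q => by
      rw [(mA2 q).2, (mB2 q).2]
      simp only [mul_pow, integral_const_mul, hA2, hB2, hcγ, hcn]
      field_simp)
    (a := (√γ)⁻¹ * (1 + K) / n) (b := (√n)⁻¹ * (1 + K') / n)
    (fun q => by
      rw [(mA3 q).2]
      simp only [abs_mul, mul_pow, integral_const_mul]
      rw [abs_of_nonneg (by positivity), pow_succ, hcγ]
      have e : γ / n * (γ⁻¹ * (√γ)⁻¹ * ∫ ω, |A ω q.1 q.2| ^ 3 ∂P)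
          = (√γ)⁻¹ * (∫ ω, |A ω q.1 q.2| ^ 3 ∂P) / n := by field_simp
      rw [e]
      have := (iA3 q).2
      gcongr)
    (fun q => by
      rw [(mB3 q).2]
      simp only [abs_mul, mul_pow, integral_const_mul]
      rw [abs_of_nonneg (by positivity), pow_succ, hcn]
      have e : (n : ℝ)⁻¹ * (√n)⁻¹ * ∫ ω, |B ω q.1 q.2| ^ 3 ∂Q
          = (√n)⁻¹ * (∫ ω, |B ω q.1 q.2| ^ 3 ∂Q) / n := by ring
      rw [e]
      have := (iB3 q).2
      gcongr)
  rw [sparseCapacity_eq hσ γ hA hAi, denseCapacity_eq hσ hB hBi, ← hp, sub_sub_sub_cancel_left,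
    ← mul_sub, abs_mul, abs_of_nonneg (by positivity), abs_sub_comm]
  calc _ ≤ 1 / (n : ℝ) * (Fintype.card (Fin m × Fin n) * (thirdDerivBound σ *
        ((√γ)⁻¹ * (1 + K) / n + (√n)⁻¹ * (1 + K') / n))) := by gcongr
    _ = _ := by
      rw [Fintype.card_prod, Fintype.card_fin, Fintype.card_fin]
      push_cast
      field_simp

end CDMA

end

theorem theorem4 (σ α : ℝ) (hσ : 0 < σ) (hα : 0 < α)
    (m : ℕ → ℕ) (hm : Tendsto (fun n : ℕ => (m n : ℝ) / n) atTop (𝓝 α))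
    {Ω : ℕ → Type*} [∀ n, MeasurableSpace (Ω n)]
    (P : ∀ n, Measure (Ω n)) [∀ n, IsProbabilityMeasure (P n)]
    (A : ∀ n, Ω n → Matrix (Fin (m n)) (Fin n) ℝ) (hA : CDMA.IsStandardType P A)
    {Ω' : ℕ → Type*} [∀ n, MeasurableSpace (Ω' n)]
    (Q : ∀ n, Measure (Ω' n)) [∀ n, IsProbabilityMeasure (Q n)]
    (B : ∀ n, Ω' n → Matrix (Fin (m n)) (Fin n) ℝ) (hB : CDMA.IsStandardType Q B) :
    Tendsto
      (fun γ : ℝ => limsup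
        (fun n : ℕ => ENNReal.ofReal
          |CDMA.sparseCapacity σ γ (P n) (A n) - CDMA.denseCapacity σ (Q n) (B n)|) atTop)
      atTop (𝓝 0) := by
  obtain ⟨K, hK⟩ := hA.sixthMoment
  obtain ⟨K', hK'⟩ := hB.sixthMoment
  set L := CDMA.thirdDerivBound σ
  -- the limit in `n` of the bound for fixed `γ`, which is valid as soon as `γ ≤ n`
  have hlim : ∀ γ : ℝ, Tendsto (fun n : ℕ => ENNReal.ofReal
      ((m n : ℝ) / n * (L * ((√γ)⁻¹ * (1 + K) + (√n)⁻¹ * (1 + K'))))) atTop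
      (𝓝 (ENNReal.ofReal (α * (L * ((√γ)⁻¹ * (1 + K) + 0 * (1 + K')))))) := by
    intro γ
    have h0 : Tendsto (fun n : ℕ => (√(n : ℝ))⁻¹) atTop (𝓝 0) :=
      (Real.tendsto_sqrt_atTop.comp tendsto_natCast_atTop_atTop).inv_tendsto_atTop
    exact ENNReal.tendsto_ofReal
      (hm.mul (((h0.mul_const (1 + K')).const_add ((√γ)⁻¹ * (1 + K))).const_mul L))
  have hbound : ∀ᶠ γ : ℝ in atTop, limsup (fun n : ℕ => ENNReal.ofReal
      |CDMA.sparseCapacity σ γ (P n) (A n) - CDMA.denseCapacity σ (Q n) (B n)|) atTop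
      ≤ ENNReal.ofReal (α * (L * ((√γ)⁻¹ * (1 + K) + 0 * (1 + K')))) := by
    filter_upwards [eventually_gt_atTop 0] with γ hγ
    rw [← (hlim γ).limsup_eq]
    refine limsup_le_limsup ?_
    filter_upwards [tendsto_natCast_atTop_atTop.eventually_ge_atTop γ] with n hn
    exact ENNReal.ofReal_le_ofReal (CDMA.abs_sparseCapacity_sub_denseCapacity_le hσ hγ hn
      (hA.measurable n) (hA.indep n) (hA.mean n) (hA.variance n) (hK n)
      (hB.measurable n) (hB.indep n) (hB.mean n) (hB.variance n) (hK' n))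
  have hzero : Tendsto (fun γ : ℝ =>
      ENNReal.ofReal (α * (L * ((√γ)⁻¹ * (1 + K) + 0 * (1 + K'))))) atTop (𝓝 0) := by
    have h0 : Tendsto (fun γ : ℝ => (√γ)⁻¹) atTop (𝓝 0) :=
      Real.tendsto_sqrt_atTop.inv_tendsto_atTop
    have h := ENNReal.tendsto_ofReal
      ((((h0.mul_const (1 + K)).add_const (0 * (1 + K'))).const_mul L).const_mul α)
    simpa using h
  exact tendsto_of_tendsto_of_tendsto_of_le_of_le' tendsto_const_nhds hzero
    (.of_forall fun _ => zero_le) hbound
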